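/- Let $d \ge 2$. For a set $E \subseteq \mathbb R^d$ write $\Delta(E) = \{|x-y| : x,y \in E\}$ for its (Euclidean) distance set. For a Borel probability measure $\mu$ on $\mathbb R^d$ put $\widehat\mu(\xi) = \int e^{-i x\cdot \xi}\,d\mu(x)$ and $\mathbb F_\mu(T) = \int_{|\xi| \le T} |\widehat\mu(\xi)|^2\,d\xi$. The measure $\mu$ is called locally uniformly $s$-dimensional if there is $C>0$ such that $\mu(Q) \le C\,\ell(Q)^s$ for all axis-parallel cubes $Q \subseteq [0,1]^d$ with side length $\ell(Q)$. With $\mathbb H^s$ denoting $s$-dimensional Hausdorff measure, a set $E \subseteq [0,1]^d$ of Hausdorff dimension $s$ is called quasi-regular if there is $\kappa>0$ such that $$\liminf_{r \to 0} \frac{\mathbb H^s(E \cap B(x;r))}{(2r)^s} \ge \kappa \quad \text{for } \mathbb H^s\text{-almost every } x \in E .$$ For $0 < \tau_1 \le \tau_2 < 1$, a finite or infinite sequence $t_1, t_2, \ldots$ in $(0,1]$ is called $(\tau_1,\tau_2)$-lacunary if $\tau_1 \le t_{j+1}/t_j \le \tau_2$ for all pairs of consecutive terms. Theorem. Given $d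 \ge 2$, $C_0 \ge 1$ and $0 < \tau_1 \le \tau_2 < 1$, there exist $\varepsilon_0 \in (0,1)$ and an integer $J_0 \ge 1$, depending only on $d, C_0, \tau_1, \tau_2$, with the following property. Let $s \in (d-\varepsilon_0, d)$, let $E \subseteq [0,1]^d$ be a quasi-regular Borel set of Hausdorff dimension $s$, and let $\mu$ be a locally uniformly $s$-dimensional Borel probability measure with $\mu(E)=1$ and $$C_0^{-1} T^{d-s} \le \mathbb F_\mu(T) \le C_0 T^{d-s} \quad \text{for all } T \ge 1 .$$ Then every $(\tau_1,\tau_2)$-lacunary sequence $t_1, \ldots, t_{J_0}$ in $(0,1]$ satisfies $\#\bigl(\Delta(E) \cap \{t_1, \ldots, t_{J_0}\}\bigr) \ge 1$. In particular, if $(t_j)_{j \ge 1}$ is an infinite $(\tau_1,\tau_2)$-lacunary sequence, then for every integer $k \ge 0$ the block $\{k+1, \ldots, k+J_0\}$ contains an index $j$ with $t_j \in \Delta(E)$. -/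

import Mathlib

open MeasureTheory Filter Topology

/-- The unit cube `[0,1]^d` in Euclidean space. -/
def unitCube (d : ℕ) : Set (EuclideanSpace ℝ (Fin d)) :=
  {x | ∀ i, x i ∈ Set.Icc (0 : ℝ) 1}

/-- The closed axis-parallel cube `c + ℓ[0,1]^d` with smallest vertex `c` and side length `ℓ`. -/
def axisCube {d : ℕ} (c : EuclideanSpace ℝ (Fin d)) (l : ℝ) : Set (EuclideanSpace ℝ (Fin d)) :=
  {x | ∀ i, x i ∈ Set.Icc (c i) (c i + l)}

/-- The distance set `Δ(E) = {|x - y| : x, y ∈ E}` (Euclidean norm). -/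
def distanceSet {d : ℕ} (E : Set (EuclideanSpace ℝ (Fin d))) : Set ℝ :=
  {r | ∃ x ∈ E, ∃ y ∈ E, ‖x - y‖ = r}

/-- The Fourier transform of a measure, `μ̂(ξ) = ∫ e^{-i x·ξ} dμ(x)`. -/
noncomputable def fourierMeasure {d : ℕ} (μ : Measure (EuclideanSpace ℝ (Fin d)))
    (ξ : EuclideanSpace ℝ (Fin d)) : ℂ :=
  ∫ x, Complex.exp (-(Complex.I * ((inner ℝ x ξ : ℝ) : ℂ))) ∂μ

/-- The partial `L²`-Fourier integral `F_μ(T) = ∫_{|ξ| ≤ T} |μ̂(ξ)|² dξ`. -/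
noncomputable def partialFourierIntegral {d : ℕ} (μ : Measure (EuclideanSpace ℝ (Fin d)))
    (T : ℝ) : ℝ :=
  ∫ ξ in Metric.closedBall (0 : EuclideanSpace ℝ (Fin d)) T, ‖fourierMeasure μ ξ‖ ^ 2

/-- `μ` is locally uniformly `s`-dimensional: `μ(Q) ≤ C ℓ(Q)^s` for all cubes `Q ⊆ [0,1]^d`. -/
def IsLocallyUniformlyDimensional {d : ℕ} (s : ℝ) (μ : Measure (EuclideanSpace ℝ (Fin d))) :
    Prop :=
  ∃ C : ℝ, 0 < C ∧ ∀ (c : EuclideanSpace ℝ (Fin d)) (l : ℝ), 0 < l →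
    axisCube c l ⊆ unitCube d → μ (axisCube c l) ≤ ENNReal.ofReal (C * l ^ s)

/-- `E` is an `s`-dimensional quasi-regular set: it has Hausdorff dimension `s`, and for some
`κ > 0` the lower `s`-density of `E` is at least `κ` at `H^s`-almost every point of `E`. -/
def IsQuasiRegular {d : ℕ} (s : ℝ) (E : Set (EuclideanSpace ℝ (Fin d))) : Prop :=
  dimH E = ENNReal.ofReal s ∧
    ∃ κ : ℝ, 0 < κ ∧
      ∀ᵐ x ∂((Measure.hausdorffMeasure s : Measure (EuclideanSpace ℝ (Fin d))).restrict E),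
        ENNReal.ofReal κ ≤
          liminf (fun r : ℝ =>
            Measure.hausdorffMeasure s (E ∩ Metric.ball x r) / ENNReal.ofReal ((2 * r) ^ s))
            (𝓝[>] (0 : ℝ))

/-- `t_1, t_2, …` is a `(τ₁, τ₂)`-lacunary sequence of length `N` (infinite if `N = ⊤`): the terms
`t_j` with `1 ≤ j ≤ N` lie in `(0, 1]`, and consecutive terms among them have ratio in `[τ₁, τ₂]`.
The other values of `t` are irrelevant. -/
def IsLacunary (τ₁ τ₂ : ℝ) (N : ℕ∞) (t : ℕ → ℝ) : Prop :=
  (∀ j : ℕ, 1 ≤ j → (j : ℕ∞) ≤ N → t j ∈ Set.Ioc (0 : ℝ) 1) ∧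
    ∀ j : ℕ, 1 ≤ j → ((j + 1 : ℕ) : ℕ∞) ≤ N →
      τ₁ ≤ t (j + 1) / t j ∧ t (j + 1) / t j ≤ τ₂

/-!
Let `σ` be a probability measure on the unit sphere with `|σ̂(ξ)| ≲ |ξ|^{-1/2}`. If `E` is compact
and `t` is not a distance of `E`, then the law of `x - y + t u`, with `x`, `y` drawn from `μ` and
`u` from `σ`, does not charge a neighbourhood of the origin; its Fourier transform `|μ̂(ξ)|²
σ̂(tξ)` therefore has integral zero. Since `Re σ̂(tξ) ≥ 1/2` for `|ξ| ≤ 1/t`, the energy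
`F_μ(1/t)` has to be compensated by the energy between `1/t` and `M/t` and by a tail of size
`M^{-1/4} t^{-(d-s)}`. For `M` large the tail is negligible, so `F_μ` grows by a definite fraction
of `t^{-(d-s)}` from `1/t` to `M/t`. When `d - s` is small, `t^{-(d-s)}` is essentially constant
along many terms of a lacunary sequence, while `F_μ` stays comparable to it, so this growth cannot
happen at every term.

A general `E` is exhausted by compact subsets; up to a constant the growth of the energy passes to
the restrictions of `μ`, because the Gaussian-weighted energy is monotone in the measure. For `σ`
one can take an iterated suspension, whose decay only requires an oscillatory integral in one
variable.
-/

/-! ### Oscillatory integrals in the angle -/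

lemma integral_inv_one_add_mul_sq_le {c : ℝ} (hc : 0 < c) (a b : ℝ) :
    ∫ x in a..b, (1 + (c * x) ^ 2)⁻¹ ≤ Real.pi / c := by
  rw [intervalIntegral.integral_comp_mul_left (fun x : ℝ => (1 + x ^ 2)⁻¹) hc.ne',
    integral_inv_one_add_sq, smul_eq_mul, div_eq_inv_mul]
  gcongr
  linarith [Real.arctan_lt_pi_div_two (c * b), Real.neg_pi_div_two_lt_arctan (c * a)]

lemma continuous_inv_one_add_mul_sin_sq {r : ℝ} (hr : 0 ≤ r) :
    Continuous fun θ : ℝ => (1 + r * Real.sin θ ^ 2)⁻¹ :=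
  Continuous.inv₀ (by fun_prop) fun θ => by positivity

lemma integral_inv_one_add_mul_sin_sq_le {r : ℝ} (hr : 0 < r) :
    ∫ θ in -Real.pi..Real.pi, (1 + r * Real.sin θ ^ 2)⁻¹ ≤ Real.pi ^ 2 / √r := by
  have hπ := Real.pi_pos
  have hcont := continuous_inv_one_add_mul_sin_sq hr.le
  have hper : Function.Periodic (fun θ : ℝ => (1 + r * Real.sin θ ^ 2)⁻¹) Real.pi := fun θ => by
    simp only [Real.sin_add_pi, neg_sq]
  have hhalf : ∫ θ in -(Real.pi / 2)..Real.pi / 2, (1 + r * Real.sin θ ^ 2)⁻¹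
      ≤ Real.pi / (2 / Real.pi * √r) := by
    refine le_trans (intervalIntegral.integral_mono_on (by linarith)
      (hcont.intervalIntegrable _ _) ?_ fun θ hθ => ?_)
      (integral_inv_one_add_mul_sq_le (by positivity) _ _)
    · exact Continuous.intervalIntegrable
        (Continuous.inv₀ (by fun_prop) fun θ => by positivity) _ _
    · have hjordan : 2 / Real.pi * |θ| ≤ |Real.sin θ| :=
        Real.mul_abs_le_abs_sin (abs_le.mpr hθ)
      rw [mul_right_comm, mul_pow, Real.sq_sqrt hr.le, mul_comm _ r, ← sq_abs (Real.sin θ),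
        ← sq_abs (_ * θ), abs_mul, abs_of_pos (show 0 < 2 / Real.pi by positivity)]
      gcongr
  have hshift (a : ℝ) : ∫ θ in a..a + Real.pi, (1 + r * Real.sin θ ^ 2)⁻¹ =
      ∫ θ in -(Real.pi / 2)..Real.pi / 2, (1 + r * Real.sin θ ^ 2)⁻¹ := by
    rw [hper.intervalIntegral_add_eq a (-(Real.pi / 2))]
    congr 1; ring
  calc ∫ θ in -Real.pi..Real.pi, (1 + r * Real.sin θ ^ 2)⁻¹
      = (∫ θ in -Real.pi..-Real.pi + Real.pi, (1 + r * Real.sin θ ^ 2)⁻¹)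
        + ∫ θ in 0..0 + Real.pi, (1 + r * Real.sin θ ^ 2)⁻¹ := by
        rw [neg_add_cancel, zero_add, intervalIntegral.integral_add_adjacent_intervals
          (hcont.intervalIntegrable _ _) (hcont.intervalIntegrable _ _)]
    _ ≤ Real.pi / (2 / Real.pi * √r) + Real.pi / (2 / Real.pi * √r) := by
        rw [hshift, hshift]; gcongr
    _ = Real.pi ^ 2 / √r := by field_simp; ring

lemma abs_div_one_add_mul_sq_le {r : ℝ} (hr : 0 < r) (s : ℝ) :
    |s| * (1 + r * s ^ 2)⁻¹ ≤ 1 / (2 * √r) := by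
  have hq : 0 < 1 + r * s ^ 2 := by positivity
  rw [← div_eq_mul_inv, div_le_div_iff₀ hq (by positivity), ← sq_abs s]
  nlinarith [sq_nonneg (√r * |s| - 1), Real.sq_sqrt hr.le]

section Oscillation

variable {w w' : ℝ → ℝ} {A A' r : ℝ}

/-- The primitive obtained by integrating `w(θ) e^{ir cos θ}` by parts: it is `w` times
`sin θ / (1 + r sin² θ)`, the regularization of `1 / (r sin θ)`. -/
noncomputable def regularizedPrimitive (w : ℝ → ℝ) (r θ : ℝ) : ℝ :=
  w θ * Real.sin θ * (1 + r * Real.sin θ ^ 2)⁻¹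

/-- The derivative of `regularizedPrimitive w r`, where `w'` is the derivative of `w`. -/
noncomputable def regularizedPrimitiveDeriv (w w' : ℝ → ℝ) (r θ : ℝ) : ℝ :=
  w' θ * Real.sin θ * (1 + r * Real.sin θ ^ 2)⁻¹ +
    w θ * Real.cos θ * (1 - r * Real.sin θ ^ 2) * (1 + r * Real.sin θ ^ 2)⁻¹ ^ 2

lemma hasDerivAt_regularizedPrimitive (hr : 0 ≤ r) {θ : ℝ} (hw : HasDerivAt w (w' θ) θ) :
    HasDerivAt (regularizedPrimitive w r) (regularizedPrimitiveDeriv w w' r θ) θ := by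
  have hq : 1 + r * Real.sin θ ^ 2 ≠ 0 := by positivity
  have hs := Real.hasDerivAt_sin θ
  refine ((hw.mul hs).mul ((((hs.pow 2).const_mul r).const_add 1).inv hq)).congr_deriv ?_
  simp only [regularizedPrimitiveDeriv, Pi.mul_apply, Pi.inv_apply, Pi.pow_apply]
  field_simp
  ring

lemma abs_regularizedPrimitiveDeriv_le (hr : 0 < r) {θ : ℝ} (hA : |w θ| ≤ A)
    (hA' : |w' θ| ≤ A') :
    |regularizedPrimitiveDeriv w w' r θ| ≤ A' / (2 * √r) + A * (1 + r * Real.sin θ ^ 2)⁻¹ := by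
  have hq : 0 < 1 + r * Real.sin θ ^ 2 := by positivity
  have hquot : |1 - r * Real.sin θ ^ 2| * (1 + r * Real.sin θ ^ 2)⁻¹ ≤ 1 := by
    rw [← div_eq_mul_inv, div_le_one hq, abs_le]
    constructor <;> nlinarith [mul_nonneg hr.le (sq_nonneg (Real.sin θ))]
  refine (abs_add_le _ _).trans (add_le_add ?_ ?_)
  · rw [mul_assoc, abs_mul, abs_mul, abs_of_pos (inv_pos.mpr hq), ← mul_one_div]
    exact mul_le_mul hA' (abs_div_one_add_mul_sq_le hr _) (by positivity)
      ((abs_nonneg _).trans hA')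
  · calc |w θ * Real.cos θ * (1 - r * Real.sin θ ^ 2) * (1 + r * Real.sin θ ^ 2)⁻¹ ^ 2|
        = |w θ| * |Real.cos θ| * (|1 - r * Real.sin θ ^ 2| * (1 + r * Real.sin θ ^ 2)⁻¹) *
            (1 + r * Real.sin θ ^ 2)⁻¹ := by
          simp only [abs_mul, abs_pow, abs_of_pos (inv_pos.mpr hq)]; ring
      _ ≤ A * 1 * 1 * (1 + r * Real.sin θ ^ 2)⁻¹ := by
          have := (abs_nonneg _).trans hA
          gcongr
          exact Real.abs_cos_le_one θ
      _ = A * (1 + r * Real.sin θ ^ 2)⁻¹ := by ring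

/-- The amplitude that replaces `w` after `w(θ) e^{ir cos θ}` has been integrated by parts. -/
noncomputable def regularizedRemainder (w w' : ℝ → ℝ) (r θ : ℝ) : ℂ :=
  (w θ * (1 + r * Real.sin θ ^ 2)⁻¹ : ℝ) - Complex.I * regularizedPrimitiveDeriv w w' r θ

lemma continuous_regularizedRemainder (hr : 0 ≤ r) (hw : Continuous w) (hw' : Continuous w') :
    Continuous (regularizedRemainder w w' r) := by
  have hq := continuous_inv_one_add_mul_sin_sq hr
  unfold regularizedRemainder regularizedPrimitiveDeriv
  fun_prop

lemma norm_regularizedRemainder_le (hr : 0 < r) {θ : ℝ} (hA : |w θ| ≤ A) (hA' : |w' θ| ≤ A') :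
    ‖regularizedRemainder w w' r θ‖ ≤
      A' / (2 * √r) + 2 * A * (1 + r * Real.sin θ ^ 2)⁻¹ := by
  have hq : 0 < (1 + r * Real.sin θ ^ 2)⁻¹ := by positivity
  refine (norm_sub_le _ _).trans ?_
  rw [norm_mul, Complex.norm_I, one_mul, Complex.norm_real, Complex.norm_real, Real.norm_eq_abs,
    Real.norm_eq_abs, abs_mul, abs_of_pos hq]
  linarith [mul_le_mul_of_nonneg_right hA hq.le, abs_regularizedPrimitiveDeriv_le hr hA hA']

lemma hasDerivAt_regularizedPrimitive_mul_exp (hr : 0 ≤ r) {θ : ℝ}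
    (hw : HasDerivAt w (w' θ) θ) :
    HasDerivAt (fun θ => Complex.I * (regularizedPrimitive w r θ : ℂ) *
        Complex.exp ((r * Real.cos θ : ℝ) * Complex.I))
      ((w θ : ℂ) * Complex.exp ((r * Real.cos θ : ℝ) * Complex.I) -
        regularizedRemainder w w' r θ * Complex.exp ((r * Real.cos θ : ℝ) * Complex.I)) θ := by
  have hq : (1 + r * (Real.sin θ : ℂ) ^ 2) ≠ 0 := by
    have : 1 + r * Real.sin θ ^ 2 ≠ 0 := by positivity
    exact_mod_cast this
  have hG := (hasDerivAt_regularizedPrimitive hr hw).ofReal_comp.const_mul Complex.I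
  have hexp := (((Real.hasDerivAt_cos θ).const_mul r).ofReal_comp.mul_const Complex.I).cexp
  refine (hG.fun_mul hexp).congr_deriv ?_
  simp only [regularizedRemainder, regularizedPrimitive, Complex.ofReal_mul, Complex.ofReal_neg,
    Complex.ofReal_inv, Complex.ofReal_add, Complex.ofReal_one, Complex.ofReal_pow]
  field_simp
  linear_combination -((w θ : ℂ) * r * Real.sin θ ^ 2) * Complex.I_sq

lemma integral_mul_exp_cos_eq (hr : 0 ≤ r) (hw : ∀ θ, HasDerivAt w (w' θ) θ)
    (hw' : Continuous w') :
    ∫ θ in -Real.pi..Real.pi, (w θ : ℂ) * Complex.exp ((r * Real.cos θ : ℝ) * Complex.I) =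
      ∫ θ in -Real.pi..Real.pi,
        regularizedRemainder w w' r θ * Complex.exp ((r * Real.cos θ : ℝ) * Complex.I) := by
  have hwc : Continuous w := continuous_iff_continuousAt.mpr fun θ => (hw θ).continuousAt
  have hgc := continuous_regularizedRemainder hr hwc hw'
  rw [← sub_eq_zero, ← intervalIntegral.integral_sub
    (Continuous.intervalIntegrable (by fun_prop) _ _)
    (Continuous.intervalIntegrable (by fun_prop) _ _),
    intervalIntegral.integral_eq_sub_of_hasDerivAt
      (fun θ _ => hasDerivAt_regularizedPrimitive_mul_exp hr (hw θ))
      (Continuous.intervalIntegrable (by fun_prop) _ _)]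
  simp [regularizedPrimitive]

theorem norm_integral_mul_exp_cos_le (hr : 0 < r) (hw : ∀ θ, HasDerivAt w (w' θ) θ)
    (hw' : Continuous w') (hA : ∀ θ, |w θ| ≤ A) (hA' : ∀ θ, |w' θ| ≤ A') :
    ‖∫ θ in -Real.pi..Real.pi, (w θ : ℂ) * Complex.exp ((r * Real.cos θ : ℝ) * Complex.I)‖ ≤
      (Real.pi * A' + 2 * Real.pi ^ 2 * A) / √r := by
  have hq := continuous_inv_one_add_mul_sin_sq hr.le
  have hA0 : 0 ≤ A := (abs_nonneg _).trans (hA 0)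
  rw [integral_mul_exp_cos_eq hr.le hw hw']
  calc ‖∫ θ in -Real.pi..Real.pi,
        regularizedRemainder w w' r θ * Complex.exp ((r * Real.cos θ : ℝ) * Complex.I)‖
      ≤ ∫ θ in -Real.pi..Real.pi, (A' / (2 * √r) + 2 * A * (1 + r * Real.sin θ ^ 2)⁻¹) := by
        refine intervalIntegral.norm_integral_le_of_norm_le (by linarith [Real.pi_pos])
          (Eventually.of_forall fun θ _ => ?_) (Continuous.intervalIntegrable (by fun_prop) _ _)
        rw [norm_mul, Complex.norm_exp_ofReal_mul_I, mul_one]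
        exact norm_regularizedRemainder_le hr (hA θ) (hA' θ)
    _ = 2 * Real.pi * (A' / (2 * √r)) +
          2 * A * ∫ θ in -Real.pi..Real.pi, (1 + r * Real.sin θ ^ 2)⁻¹ := by
        rw [intervalIntegral.integral_add (Continuous.intervalIntegrable (by fun_prop) _ _)
          (Continuous.intervalIntegrable (by fun_prop) _ _), intervalIntegral.integral_const,
          intervalIntegral.integral_const_mul, smul_eq_mul]
        ring
    _ ≤ 2 * Real.pi * (A' / (2 * √r)) + 2 * A * (Real.pi ^ 2 / √r) := by
        gcongr; exact integral_inv_one_add_mul_sin_sq_le hr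
    _ = (Real.pi * A' + 2 * Real.pi ^ 2 * A) / √r := by ring

lemma re_mul_cos_add_im_mul_sin (z : ℂ) (θ : ℝ) :
    z.re * Real.cos (θ + z.arg) + z.im * Real.sin (θ + z.arg) = ‖z‖ * Real.cos θ := by
  rw [Real.cos_add, Real.sin_add, ← Complex.norm_mul_cos_arg z, ← Complex.norm_mul_sin_arg z]
  linear_combination (‖z‖ * Real.cos θ) * Real.sin_sq_add_cos_sq z.arg

theorem norm_integral_mul_exp_cos_add_sin_le {z : ℂ} (hz : z ≠ 0)
    (hw : ∀ θ, HasDerivAt w (w' θ) θ) (hw' : Continuous w')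
    (hper : Function.Periodic w (2 * Real.pi)) (hA : ∀ θ, |w θ| ≤ A) (hA' : ∀ θ, |w' θ| ≤ A') :
    ‖∫ θ in -Real.pi..Real.pi, (w θ : ℂ) *
        Complex.exp ((z.re * Real.cos θ + z.im * Real.sin θ : ℝ) * Complex.I)‖ ≤
      (Real.pi * A' + 2 * Real.pi ^ 2 * A) / √‖z‖ := by
  set f : ℝ → ℂ := fun θ => (w θ : ℂ) *
    Complex.exp ((z.re * Real.cos θ + z.im * Real.sin θ : ℝ) * Complex.I)
  have hf : Function.Periodic f (2 * Real.pi) := fun θ => by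
    simp only [f, hper θ, Real.cos_add_two_pi, Real.sin_add_two_pi]
  have hrotate : ∫ θ in -Real.pi..Real.pi, f θ = ∫ θ in -Real.pi..Real.pi,
      (w (θ + z.arg) : ℂ) * Complex.exp ((‖z‖ * Real.cos θ : ℝ) * Complex.I) := by
    have hshift := hf.intervalIntegral_add_eq (-Real.pi) (-Real.pi + z.arg)
    rw [show -Real.pi + 2 * Real.pi = Real.pi by ring,
      show -Real.pi + z.arg + 2 * Real.pi = Real.pi + z.arg by ring,
      ← intervalIntegral.integral_comp_add_right] at hshift
    simp only [hshift, f, re_mul_cos_add_im_mul_sin]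
  rw [hrotate]
  exact norm_integral_mul_exp_cos_le (norm_pos_iff.mpr hz)
    (fun θ => (hw (θ + z.arg)).comp_add_const θ z.arg) (by fun_prop) (fun _ => hA _)
    fun _ => hA' _

end Oscillation

/-- The probability law of density `cos² θ / π` on `(-π, π]`, used to draw the angle of a random
point of a sphere with respect to a pole. -/
noncomputable def angleLaw : Measure ℝ :=
  (volume.restrict (Set.Ioc (-Real.pi) Real.pi)).withDensity
    fun θ => ENNReal.ofReal (Real.cos θ ^ 2 / Real.pi)

lemma integral_angleLaw {E : Type*} [NormedAddCommGroup E] [NormedSpace ℝ E] (f : ℝ → E) :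
    ∫ θ, f θ ∂angleLaw = ∫ θ in -Real.pi..Real.pi, (Real.cos θ ^ 2 / Real.pi) • f θ := by
  rw [angleLaw, integral_withDensity_eq_integral_toReal_smul (by fun_prop)
    (Eventually.of_forall fun _ => ENNReal.ofReal_lt_top),
    intervalIntegral.integral_of_le (by linarith [Real.pi_pos])]
  refine integral_congr_ae (Eventually.of_forall fun θ => ?_)
  simp only [ENNReal.toReal_ofReal (show 0 ≤ Real.cos θ ^ 2 / Real.pi by positivity)]

instance : IsProbabilityMeasure angleLaw := by
  constructor
  rw [angleLaw, withDensity_apply _ MeasurableSet.univ, Measure.restrict_univ,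
    ← ofReal_integral_eq_lintegral_ofReal
      ((Continuous.integrableOn_Icc (by fun_prop)).mono_set Set.Ioc_subset_Icc_self)
      (Eventually.of_forall fun θ => by positivity),
    ← intervalIntegral.integral_of_le (by linarith [Real.pi_pos]),
    intervalIntegral.integral_div, integral_cos_sq]
  simp [Real.pi_ne_zero]

theorem sqrt_norm_mul_norm_integral_angleLaw_exp_le (z : ℂ) :
    √‖z‖ * ‖∫ θ, Complex.exp ((z.re * Real.cos θ + z.im * Real.sin θ : ℝ) * Complex.I)
      ∂angleLaw‖ ≤ 8 := by
  have hπ := Real.pi_pos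
  rcases eq_or_ne z 0 with rfl | hz
  · simp
  have hderiv (θ : ℝ) : HasDerivAt (fun θ => Real.cos θ ^ 2) (-Real.sin (2 * θ)) θ :=
    ((Real.hasDerivAt_cos θ).fun_pow 2).congr_deriv (by
      rw [Real.sin_two_mul]; norm_num; ring)
  have hosc := norm_integral_mul_exp_cos_add_sin_le (A := 1) (A' := 1) hz hderiv (by fun_prop)
    (fun θ => by rw [Real.cos_add_two_pi])
    (fun θ => by rw [abs_of_nonneg (sq_nonneg _)]; exact Real.cos_sq_le_one _)
    (fun θ => by rw [abs_neg]; exact Real.abs_sin_le_one _)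
  rw [← le_div_iff₀' (by positivity)]
  simp_rw [integral_angleLaw, Complex.real_smul, Complex.ofReal_div, div_eq_inv_mul, mul_assoc]
  rw [intervalIntegral.integral_const_mul, norm_mul, norm_inv, Complex.norm_real,
    Real.norm_of_nonneg hπ.le]
  refine (mul_le_mul_of_nonneg_left hosc (by positivity)).trans ?_
  rw [mul_div_assoc', div_eq_inv_mul]
  gcongr
  field_simp
  linarith [Real.pi_lt_d2]

/-! ### A measure on the sphere with Fourier decay -/

section Suspension

open scoped InnerProductSpace

variable {V : Type*} [NormedAddCommGroup V] [InnerProductSpace ℝ V] [MeasurableSpace V]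

/-- Decay of order `1/2` of the Fourier transform of `σ` in the direction `v`. It is inherited by
suspensions, so decay in all directions can be established one direction at a time. -/
def HasDirectionalDecay (σ : Measure V) (v : V) (B : ℝ) : Prop :=
  ∀ ξ, √|⟪v, ξ⟫_ℝ| * ‖charFun σ ξ‖ ≤ B

variable [BorelSpace V] [SecondCountableTopology V] {e v : V} {σ : Measure V}

/-- The law of `sin θ • e + cos θ • x` for a random angle `θ` and an independent random `x` with law
`σ`. If `σ` lives on the unit sphere of a subspace orthogonal to the unit vector `e`, then this
measure lives on the unit sphere of a subspace with one more dimension. -/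
noncomputable def suspension (e : V) (σ : Measure V) : Measure V :=
  (angleLaw.prod σ).map fun p => Real.sin p.1 • e + Real.cos p.1 • p.2

instance [IsProbabilityMeasure σ] : IsProbabilityMeasure (suspension e σ) :=
  Measure.isProbabilityMeasure_map (by fun_prop)

lemma ae_suspension [SFinite σ] {p : V → Prop} (hp : MeasurableSet {x | p x})
    (h : ∀ᵐ x ∂σ, ∀ θ : ℝ, p (Real.sin θ • e + Real.cos θ • x)) : ∀ᵐ x ∂suspension e σ, p x := by
  rw [suspension, ae_map_iff (by fun_prop) hp]
  filter_upwards [Measure.quasiMeasurePreserving_snd.ae h] with q hq using hq q.1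

lemma ae_inner_suspension_eq_zero [SFinite σ] (he : ⟪v, e⟫_ℝ = 0) (h : ∀ᵐ x ∂σ, ⟪v, x⟫_ℝ = 0) :
    ∀ᵐ x ∂suspension e σ, ⟪v, x⟫_ℝ = 0 := by
  refine ae_suspension (measurableSet_eq_fun (by fun_prop) (by fun_prop)) ?_
  filter_upwards [h] with x hx θ
  rw [inner_add_right, inner_smul_right, inner_smul_right, he, hx, mul_zero, mul_zero, add_zero]

lemma ae_norm_suspension_eq_one [SFinite σ] (he : ‖e‖ = 1) (h : ∀ᵐ x ∂σ, ⟪e, x⟫_ℝ = 0)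
    (hσ : ∀ᵐ x ∂σ, ‖x‖ = 1) : ∀ᵐ x ∂suspension e σ, ‖x‖ = 1 := by
  refine ae_suspension (measurableSet_eq_fun (by fun_prop) (by fun_prop)) ?_
  filter_upwards [h, hσ] with x hx hx1 θ
  rw [← sq_eq_sq₀ (norm_nonneg _) zero_le_one, norm_add_sq_real, norm_smul, norm_smul,
    real_inner_smul_left, real_inner_smul_right, he, hx, hx1]
  simp

lemma integrable_exp_suspension_phase [IsFiniteMeasure σ] (ξ : V) :
    Integrable (fun p : ℝ × V => Complex.exp
      ((⟪p.2, ξ⟫_ℝ * Real.cos p.1 + ⟪e, ξ⟫_ℝ * Real.sin p.1 : ℝ) * Complex.I))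
      (angleLaw.prod σ) := by
  refine Integrable.of_bound (C := 1) (by fun_prop) (Eventually.of_forall fun p => ?_)
  rw [Complex.norm_exp_ofReal_mul_I]

lemma charFun_suspension [IsFiniteMeasure σ] (ξ : V) :
    charFun (suspension e σ) ξ = ∫ p : ℝ × V, Complex.exp
      ((⟪p.2, ξ⟫_ℝ * Real.cos p.1 + ⟪e, ξ⟫_ℝ * Real.sin p.1 : ℝ) * Complex.I)
      ∂angleLaw.prod σ := by
  rw [charFun_apply, suspension, integral_map (by fun_prop) (by fun_prop)]
  congr 1 with p
  rw [inner_add_left, real_inner_smul_left, real_inner_smul_left]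
  ring_nf

/-- The decay comes from the oscillation in the angle, for each fixed `x`. -/
lemma sqrt_abs_mul_norm_charFun_suspension_le [IsProbabilityMeasure σ] {c : ℝ} {ξ : V}
    (h : ∀ᵐ x ∂σ, |c| ≤ max |⟪x, ξ⟫_ℝ| |⟪e, ξ⟫_ℝ|) :
    √|c| * ‖charFun (suspension e σ) ξ‖ ≤ 8 := by
  rcases eq_or_ne c 0 with rfl | hc
  · simp
  have hc' : 0 < √|c| := by positivity
  rw [charFun_suspension, integral_prod_symm _ (integrable_exp_suspension_phase ξ),
    ← le_div_iff₀' hc']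
  refine (norm_integral_le_of_norm_le_const (C := 8 / √|c|) ?_).trans_eq (by simp)
  filter_upwards [h] with x hx
  set z : ℂ := ⟨⟪x, ξ⟫_ℝ, ⟪e, ξ⟫_ℝ⟩
  rw [le_div_iff₀' hc']
  refine le_trans ?_ (sqrt_norm_mul_norm_integral_angleLaw_exp_le z)
  gcongr
  exact hx.trans (max_le (Complex.abs_re_le_norm z) (Complex.abs_im_le_norm z))

lemma hasDirectionalDecay_suspension_self [IsProbabilityMeasure σ] :
    HasDirectionalDecay (suspension e σ) e 8 := fun _ =>
  sqrt_abs_mul_norm_charFun_suspension_le (Eventually.of_forall fun _ => le_max_right _ _)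

lemma hasDirectionalDecay_suspension_dirac :
    HasDirectionalDecay (suspension e (Measure.dirac v)) v 8 := fun _ =>
  sqrt_abs_mul_norm_charFun_suspension_le
    (by rw [ae_dirac_eq, eventually_pure]; exact le_max_left _ _)

lemma norm_charFun_suspension_le [IsProbabilityMeasure σ] (ξ : V) :
    ‖charFun (suspension e σ) ξ‖ ≤ ∫ θ, ‖charFun σ (Real.cos θ • ξ)‖ ∂angleLaw := by
  rw [charFun_suspension, integral_prod _ (integrable_exp_suspension_phase ξ)]
  refine (norm_integral_le_integral_norm _).trans_eq ?_
  congr 1 with θ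
  have hsplit (x : V) : Complex.exp
      ((⟪x, ξ⟫_ℝ * Real.cos θ + ⟪e, ξ⟫_ℝ * Real.sin θ : ℝ) * Complex.I) =
      Complex.exp ((⟪e, ξ⟫_ℝ * Real.sin θ : ℝ) * Complex.I) *
        Complex.exp (⟪x, Real.cos θ • ξ⟫_ℝ * Complex.I) := by
    rw [← Complex.exp_add, real_inner_smul_right]
    push_cast
    ring_nf
  simp only [hsplit]
  rw [integral_const_mul, norm_mul, Complex.norm_exp_ofReal_mul_I, one_mul, ← charFun_apply]

lemma sq_le_sqrt_abs {x : ℝ} (hx : |x| ≤ 1) : x ^ 2 ≤ √|x| :=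
  Real.le_sqrt_of_sq_le <| calc
    (x ^ 2) ^ 2 = |x| ^ 4 := by rw [← sq_abs x]; ring
    _ ≤ |x| := pow_le_of_le_one (abs_nonneg x) hx (by norm_num)

/-- The weight `cos² θ` of the angle law absorbs the loss `√|cos θ|` from the shrunken frequency
`cos θ • ξ`. -/
lemma HasDirectionalDecay.to_suspension [IsProbabilityMeasure σ] {B : ℝ}
    (h : HasDirectionalDecay σ v B) : HasDirectionalDecay (suspension e σ) v (2 * B) := by
  intro ξ
  have hπ := Real.pi_pos
  have hweight (θ : ℝ) : Real.cos θ ^ 2 / Real.pi *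
      (√|⟪v, ξ⟫_ℝ| * ‖charFun σ (Real.cos θ • ξ)‖) ≤ B / Real.pi := by
    rw [div_mul_eq_mul_div]
    gcongr
    refine le_trans ?_ (h (Real.cos θ • ξ))
    rw [real_inner_smul_right, abs_mul, Real.sqrt_mul (abs_nonneg _), mul_assoc]
    gcongr
    exact sq_le_sqrt_abs (Real.abs_cos_le_one θ)
  calc √|⟪v, ξ⟫_ℝ| * ‖charFun (suspension e σ) ξ‖
      ≤ √|⟪v, ξ⟫_ℝ| * ∫ θ, ‖charFun σ (Real.cos θ • ξ)‖ ∂angleLaw := by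
        gcongr; exact norm_charFun_suspension_le ξ
    _ = ∫ θ in -Real.pi..Real.pi, Real.cos θ ^ 2 / Real.pi *
          (√|⟪v, ξ⟫_ℝ| * ‖charFun σ (Real.cos θ • ξ)‖) := by
        rw [← integral_const_mul, integral_angleLaw]; rfl
    _ ≤ ∫ _ in -Real.pi..Real.pi, B / Real.pi := by
        refine intervalIntegral.integral_mono_on (by linarith) ?_
          intervalIntegrable_const fun θ _ => hweight θ
        have := continuous_charFun (μ := σ)
        exact Continuous.intervalIntegrable (by fun_prop) _ _
    _ = 2 * B := by
        rw [intervalIntegral.integral_const, smul_eq_mul]; field_simp; ring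

end Suspension

section FourierDecay

open scoped InnerProductSpace

lemma sqrt_add_le_sqrt_add_sqrt (x y : ℝ) : √(x + y) ≤ √x + √y := by
  have le_sq_sqrt (z : ℝ) : z ≤ √z ^ 2 :=
    (le_total 0 z).elim (fun h => (Real.sq_sqrt h).ge) fun h => h.trans (sq_nonneg _)
  rw [Real.sqrt_le_left (by positivity)]
  nlinarith [le_sq_sqrt x, le_sq_sqrt y, mul_nonneg (Real.sqrt_nonneg x) (Real.sqrt_nonneg y)]

lemma sqrt_norm_le_sum_sqrt_abs_inner {V ι : Type*} [NormedAddCommGroup V] [InnerProductSpace ℝ V]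
    [Fintype ι] (b : OrthonormalBasis ι ℝ V) (ξ : V) : √‖ξ‖ ≤ ∑ i, √|⟪b i, ξ⟫_ℝ| := by
  have hnorm : ‖ξ‖ ≤ ∑ i, |⟪b i, ξ⟫_ℝ| := by
    conv_lhs => rw [← b.sum_repr' ξ]
    refine (norm_sum_le _ _).trans_eq (Finset.sum_congr rfl fun i _ => ?_)
    rw [norm_smul, b.norm_eq_one, mul_one, Real.norm_eq_abs]
  exact (Real.sqrt_le_sqrt hnorm).trans
    (Finset.le_sum_of_subadditive _ Real.sqrt_zero.le sqrt_add_le_sqrt_add_sqrt _ _)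

/-- Decay of order `α` of the Fourier transform of `σ`, stated as a product so that it holds
trivially at `ξ = 0`. -/
def HasFourierDecay {V : Type*} [NormedAddCommGroup V] [InnerProductSpace ℝ V] [MeasurableSpace V]
    (σ : Measure V) (α B : ℝ) : Prop :=
  ∀ ξ, ‖ξ‖ ^ α * ‖charFun σ ξ‖ ≤ B

variable {V : Type*} [NormedAddCommGroup V] [InnerProductSpace ℝ V] [MeasurableSpace V]

lemma HasFourierDecay.nonneg {σ : Measure V} {α B : ℝ} (hσ : HasFourierDecay σ α B) : 0 ≤ B :=
  (by positivity : 0 ≤ ‖(0 : V)‖ ^ α * ‖charFun σ (0 : V)‖).trans (hσ 0)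

lemma HasFourierDecay.norm_charFun_smul_le {σ : Measure V} {α B t : ℝ}
    (hσ : HasFourierDecay σ α B) (ht : 0 < t) {ξ : V} (hξ : ξ ≠ 0) :
    ‖charFun σ (t • ξ)‖ ≤ B * t ^ (-α) * ‖ξ‖⁻¹ ^ α := by
  have hξ0 : 0 < ‖ξ‖ := norm_pos_iff.mpr hξ
  have h := hσ (t • ξ)
  rw [norm_smul, Real.norm_of_nonneg ht.le, Real.mul_rpow ht.le hξ0.le] at h
  rw [Real.rpow_neg ht.le, Real.inv_rpow hξ0.le, mul_assoc, ← mul_inv, ← div_eq_mul_inv,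
    le_div_iff₀ (by positivity), mul_comm]
  exact h

lemma HasDirectionalDecay.mono {σ : Measure V} {v : V} {B B' : ℝ}
    (h : HasDirectionalDecay σ v B) (hB : B ≤ B') : HasDirectionalDecay σ v B' :=
  fun ξ => (h ξ).trans hB

variable [BorelSpace V]

lemma exists_sphere_law_hasDirectionalDecay [SecondCountableTopology V] {ι : Type*} {v : ι → V}
    (hv : Orthonormal ℝ v) {n : ℕ} (hn : 2 ≤ n) :
    ∀ s : Finset ι, s.card = n → ∃ σ : Measure V, IsProbabilityMeasure σ ∧
      (∀ᵐ x ∂σ, ‖x‖ = 1) ∧ (∀ j ∉ s, ∀ᵐ x ∂σ, ⟪v j, x⟫_ℝ = 0) ∧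
      ∃ B, ∀ i ∈ s, HasDirectionalDecay σ (v i) B := by
  classical
  induction n, hn using Nat.le_induction with
  | base =>
    intro s hs
    obtain ⟨i, j, hij, rfl⟩ := Finset.card_eq_two.mp hs
    refine ⟨suspension (v i) (Measure.dirac (v j)), inferInstance, ?_, fun k hk => ?_, 8, ?_⟩
    · refine ae_norm_suspension_eq_one (hv.1 i) ?_ ?_ <;> rw [ae_dirac_eq, eventually_pure]
      exacts [hv.2 hij, hv.1 j]
    · simp only [Finset.mem_insert, Finset.mem_singleton, not_or] at hk
      refine ae_inner_suspension_eq_zero (hv.2 hk.1) ?_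
      rw [ae_dirac_eq, eventually_pure]
      exact hv.2 hk.2
    · simp only [Finset.mem_insert, Finset.mem_singleton, forall_eq_or_imp, forall_eq]
      exact ⟨hasDirectionalDecay_suspension_self, hasDirectionalDecay_suspension_dirac⟩
  | succ n _ ih =>
    intro s hs
    obtain ⟨i, s, his, rfl, hcard⟩ := Finset.card_eq_succ.mp hs
    obtain ⟨σ, _, hnorm, horth, B, hB⟩ := ih s hcard
    refine ⟨suspension (v i) σ, inferInstance,
      ae_norm_suspension_eq_one (hv.1 i) (horth i his) hnorm, fun j hj => ?_, max 8 (2 * B), ?_⟩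
    · rw [Finset.mem_insert, not_or] at hj
      exact ae_inner_suspension_eq_zero (hv.2 hj.1) (horth j hj.2)
    · simp only [Finset.mem_insert, forall_eq_or_imp]
      exact ⟨hasDirectionalDecay_suspension_self.mono (le_max_left _ _),
        fun j hj => (hB j hj).to_suspension.mono (le_max_right _ _)⟩

theorem exists_sphere_law_hasFourierDecay [FiniteDimensional ℝ V]
    (hV : 2 ≤ Module.finrank ℝ V) :
    ∃ σ : Measure V, IsProbabilityMeasure σ ∧ (∀ᵐ x ∂σ, ‖x‖ = 1) ∧
      ∃ B, HasFourierDecay σ (1 / 2) B := by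
  set b := stdOrthonormalBasis ℝ V
  obtain ⟨σ, hprob, hnorm, -, B, hB⟩ := exists_sphere_law_hasDirectionalDecay b.orthonormal hV
    Finset.univ (by simp)
  refine ⟨σ, hprob, hnorm, ∑ _i : Fin (Module.finrank ℝ V), B, fun ξ => ?_⟩
  calc ‖ξ‖ ^ (1 / 2 : ℝ) * ‖charFun σ ξ‖ = √‖ξ‖ * ‖charFun σ ξ‖ := by rw [Real.sqrt_eq_rpow]
    _ ≤ (∑ i, √|⟪b i, ξ⟫_ℝ|) * ‖charFun σ ξ‖ := by gcongr; exact sqrt_norm_le_sum_sqrt_abs_inner b ξ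
    _ ≤ ∑ _i, B := by
      rw [Finset.sum_mul]
      exact Finset.sum_le_sum fun i hi => hB i hi ξ

end FourierDecay

/-! ### Fourier transforms tested against Gaussians -/

section Gaussian

open scoped InnerProductSpace

variable {V : Type*} [NormedAddCommGroup V] [InnerProductSpace ℝ V] [FiniteDimensional ℝ V]
  [MeasurableSpace V] [BorelSpace V] {b : ℝ}

lemma integrable_exp_neg_mul_norm_sq (hb : 0 < b) :
    Integrable fun ξ : V => Real.exp (-b * ‖ξ‖ ^ 2) := by
  refine (GaussianFourier.integrable_cexp_neg_mul_sq_norm_add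
    (show 0 < (b : ℂ).re from hb) 0 (0 : V)).norm.congr (Eventually.of_forall fun ξ => ?_)
  simp [Complex.norm_exp, ← Complex.ofReal_pow]

lemma integral_exp_neg_mul_norm_sq_mul_cexp_inner (hb : 0 < b) (z : V) :
    ∫ ξ : V, (Real.exp (-b * ‖ξ‖ ^ 2) : ℂ) * Complex.exp (⟪z, ξ⟫_ℝ * Complex.I) =
      ((Real.pi / b) ^ (Module.finrank ℝ V / 2 : ℝ) * Real.exp (-‖z‖ ^ 2 / (4 * b)) : ℝ) := by
  have h := GaussianFourier.integral_cexp_neg_mul_sq_norm_add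
    (show 0 < (b : ℂ).re from hb) Complex.I z
  have hexp : Complex.I ^ 2 * (‖z‖ : ℂ) ^ 2 / (4 * b) = ((-‖z‖ ^ 2 / (4 * b) : ℝ) : ℂ) := by
    rw [Complex.I_sq]; push_cast; ring
  have hdim : (Module.finrank ℝ V / 2 : ℂ) = ((Module.finrank ℝ V / 2 : ℝ) : ℂ) := by
    push_cast; rfl
  rw [hexp, hdim, ← Complex.ofReal_div, ← Complex.ofReal_cpow (by positivity),
    ← Complex.ofReal_exp, ← Complex.ofReal_mul] at h
  rw [← h]
  congr 1 with ξ
  rw [Complex.ofReal_exp, ← Complex.exp_add]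
  push_cast
  ring_nf

lemma integral_exp_neg_mul_norm_sq_mul_charFun (ν : Measure V) [IsFiniteMeasure ν] (hb : 0 < b) :
    ∫ ξ : V, (Real.exp (-b * ‖ξ‖ ^ 2) : ℂ) * charFun ν ξ =
      ((Real.pi / b) ^ (Module.finrank ℝ V / 2 : ℝ) *
        ∫ z, Real.exp (-‖z‖ ^ 2 / (4 * b)) ∂ν : ℝ) := by
  have hint : Integrable (fun p : V × V =>
      (Real.exp (-b * ‖p.1‖ ^ 2) : ℂ) * Complex.exp (⟪p.2, p.1⟫_ℝ * Complex.I))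
      (volume.prod ν) := by
    refine (((integrable_exp_neg_mul_norm_sq hb).comp_fst ν).mono' (by fun_prop)
      (Eventually.of_forall fun p => ?_))
    rw [norm_mul, Complex.norm_exp_ofReal_mul_I, mul_one, Complex.norm_real,
      Real.norm_of_nonneg (Real.exp_nonneg _)]
  simp_rw [charFun_apply, ← integral_const_mul]
  rw [integral_integral_swap hint]
  simp_rw [integral_exp_neg_mul_norm_sq_mul_cexp_inner hb]
  rw [integral_complex_ofReal]

lemma tendsto_rpow_mul_exp_neg_div_nhdsGT_zero (p : ℝ) {η : ℝ} (hη : 0 < η) :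
    Tendsto (fun b : ℝ => (Real.pi / b) ^ p * Real.exp (-η / (4 * b))) (𝓝[>] 0) (𝓝 0) := by
  have h := ((tendsto_rpow_mul_exp_neg_mul_atTop_nhds_zero p (η / 4)
    (by positivity)).comp tendsto_inv_nhdsGT_zero).const_mul (Real.pi ^ p)
  rw [mul_zero] at h
  refine h.congr' ?_
  filter_upwards [self_mem_nhdsWithin] with b (hb : 0 < b)
  rw [Function.comp_apply, div_eq_mul_inv Real.pi b, Real.mul_rpow Real.pi_pos.le (by positivity),
    mul_assoc]
  congr 3
  field_simp

theorem integral_charFun_eq_zero_of_ae_le_norm {ν : Measure V} [IsFiniteMeasure ν] {η : ℝ}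
    (hη : 0 < η) (hν : ∀ᵐ z ∂ν, η ≤ ‖z‖) (hint : Integrable (charFun ν)) :
    ∫ ξ, charFun ν ξ = 0 := by
  have hlim : Tendsto (fun b : ℝ => ∫ ξ : V, (Real.exp (-b * ‖ξ‖ ^ 2) : ℂ) * charFun ν ξ)
      (𝓝[>] 0) (𝓝 (∫ ξ, charFun ν ξ)) := by
    refine tendsto_integral_filter_of_dominated_convergence (fun ξ => ‖charFun ν ξ‖)
      (Eventually.of_forall fun b => ?_) ?_ hint.norm (Eventually.of_forall fun ξ => ?_)
    · have := continuous_charFun (μ := ν)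
      exact Continuous.aestronglyMeasurable (by fun_prop)
    · filter_upwards [self_mem_nhdsWithin] with b (hb : 0 < b)
      refine Eventually.of_forall fun ξ => ?_
      rw [norm_mul, Complex.norm_real, Real.norm_of_nonneg (Real.exp_nonneg _)]
      refine mul_le_of_le_one_left (norm_nonneg _) (Real.exp_le_one_iff.mpr ?_)
      nlinarith [sq_nonneg ‖ξ‖]
    · have : Continuous fun b : ℝ => (Real.exp (-b * ‖ξ‖ ^ 2) : ℂ) * charFun ν ξ := by fun_prop
      simpa using (this.tendsto 0).mono_left nhdsWithin_le_nhds
  refine tendsto_nhds_unique hlim (squeeze_zero_norm' ?_ (by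
    simpa using (tendsto_rpow_mul_exp_neg_div_nhdsGT_zero
      (Module.finrank ℝ V / 2) (pow_pos hη 2)).mul_const (ν.real Set.univ)))
  filter_upwards [self_mem_nhdsWithin] with b (hb : 0 < b)
  rw [integral_exp_neg_mul_norm_sq_mul_charFun ν hb, Complex.norm_real, norm_mul,
    Real.norm_of_nonneg (by positivity), mul_assoc]
  gcongr
  refine norm_integral_le_of_norm_le_const ?_
  filter_upwards [hν] with z hz
  rw [Real.norm_of_nonneg (Real.exp_nonneg _)]
  gcongr

end Gaussian

lemma ae_conv {M : Type*} [AddMonoid M] [MeasurableSpace M] [MeasurableAdd₂ M] {μ ν : Measure M}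
    [SFinite μ] [SFinite ν] {p q r : M → Prop} (hr : MeasurableSet {z | r z})
    (hp : ∀ᵐ x ∂μ, p x) (hq : ∀ᵐ y ∂ν, q y) (h : ∀ x y, p x → q y → r (x + y)) :
    ∀ᵐ z ∂(μ ∗ ν), r z := by
  rw [Measure.conv, ae_map_iff (by fun_prop) hr]
  filter_upwards [Measure.quasiMeasurePreserving_fst.ae hp,
    Measure.quasiMeasurePreserving_snd.ae hq] with z hz₁ hz₂ using h _ _ hz₁ hz₂

lemma conv_mono_measure {M : Type*} [AddMonoid M] [MeasurableSpace M] [MeasurableAdd₂ M]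
    {μ μ' ν ν' : Measure M} [SFinite ν] [SFinite ν'] (hμ : μ' ≤ μ) (hν : ν' ≤ ν) :
    μ' ∗ ν' ≤ μ ∗ ν := by
  refine Measure.map_mono (Measure.le_iff.mpr fun s hs => ?_) (by fun_prop)
  rw [Measure.prod_apply hs, Measure.prod_apply hs]
  exact lintegral_mono' hμ fun x => hν _

lemma exists_pos_le_abs_norm_sub {V : Type*} [NormedAddCommGroup V] {K : Set V}
    (hK : IsCompact K) {t : ℝ} (ht : ∀ z ∈ K, ‖z‖ ≠ t) : ∃ η > 0, ∀ z ∈ K, η ≤ |‖z‖ - t| := by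
  have hclosed : IsClosed (norm '' K) := (hK.image continuous_norm).isClosed
  obtain ⟨η, hη, hball⟩ := Metric.isOpen_iff.mp hclosed.isOpen_compl t (by simpa using ht)
  refine ⟨η, hη, fun z hz => not_lt.mp fun hlt => hball ?_ (Set.mem_image_of_mem _ hz)⟩
  rwa [Metric.mem_ball, Real.dist_eq]

section Difference

open scoped Pointwise

variable {V : Type*} [NormedAddCommGroup V] [MeasurableSpace V]

/-- The law of `x - y` for independent `x` and `y` with law `μ`; its Fourier transform is
`|μ̂|²`. -/
noncomputable def differenceLaw (μ : Measure V) : Measure V :=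
  μ ∗ μ.map Neg.neg

variable [BorelSpace V] [SecondCountableTopology V] {μ μ' : Measure V}

instance [IsFiniteMeasure μ] : IsFiniteMeasure (differenceLaw μ) := by
  unfold differenceLaw; infer_instance

lemma ae_differenceLaw_mem_sub [SFinite μ] {K : Set V} (hK : IsCompact K)
    (hμ : ∀ᵐ x ∂μ, x ∈ K) : ∀ᵐ z ∂differenceLaw μ, z ∈ K - K := by
  have hneg : ∀ᵐ y ∂μ.map Neg.neg, -y ∈ K := by
    refine (ae_map_iff (p := (-· ∈ K)) (by fun_prop) hK.neg.isClosed.measurableSet).mpr ?_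
    simpa only [neg_neg] using hμ
  rw [sub_eq_add_neg]
  exact ae_conv (hK.add hK.neg).isClosed.measurableSet hμ hneg fun x y hx hy =>
    Set.add_mem_add hx hy

lemma differenceLaw_mono [SFinite μ] [SFinite μ'] (h : μ' ≤ μ) :
    differenceLaw μ' ≤ differenceLaw μ :=
  conv_mono_measure h (Measure.map_mono h measurable_neg)

lemma charFun_differenceLaw [InnerProductSpace ℝ V] [IsFiniteMeasure μ] (ξ : V) :
    charFun (differenceLaw μ) ξ = (‖charFun μ ξ‖ ^ 2 : ℝ) := by
  have hneg : (Neg.neg : V → V) = ((-1 : ℝ) • ·) := by ext x; rw [neg_one_smul]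
  rw [differenceLaw, charFun_conv, hneg, charFun_map_smul, neg_one_smul, charFun_neg,
    Complex.mul_conj, Complex.normSq_eq_norm_sq]

end Difference

section Gaussian

variable {V : Type*} [NormedAddCommGroup V] [InnerProductSpace ℝ V] [FiniteDimensional ℝ V]
  [MeasurableSpace V] [BorelSpace V] {μ μ' : Measure V}

lemma integral_exp_neg_mul_norm_sq_mul_norm_charFun_sq_mono [IsFiniteMeasure μ] [IsFiniteMeasure μ']
    (h : μ' ≤ μ) {b : ℝ} (hb : 0 < b) :
    ∫ ξ : V, Real.exp (-b * ‖ξ‖ ^ 2) * ‖charFun μ' ξ‖ ^ 2 ≤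
      ∫ ξ : V, Real.exp (-b * ‖ξ‖ ^ 2) * ‖charFun μ ξ‖ ^ 2 := by
  have hformula (ν : Measure V) [IsFiniteMeasure ν] :
      ∫ ξ : V, Real.exp (-b * ‖ξ‖ ^ 2) * ‖charFun ν ξ‖ ^ 2 =
        (Real.pi / b) ^ (Module.finrank ℝ V / 2 : ℝ) *
          ∫ z, Real.exp (-‖z‖ ^ 2 / (4 * b)) ∂differenceLaw ν := by
    rw [← Complex.ofReal_inj, ← integral_exp_neg_mul_norm_sq_mul_charFun _ hb,
      ← integral_complex_ofReal]
    simp only [charFun_differenceLaw, Complex.ofReal_mul]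
  rw [hformula, hformula]
  refine mul_le_mul_of_nonneg_left (integral_mono_measure (differenceLaw_mono h)
    (Eventually.of_forall fun z => Real.exp_nonneg _) ?_) (by positivity)
  refine Integrable.of_bound (C := 1) (by fun_prop) (Eventually.of_forall fun z => ?_)
  rw [Real.norm_of_nonneg (Real.exp_nonneg _), Real.exp_le_one_iff]
  exact div_nonpos_of_nonpos_of_nonneg (by simp) (by positivity)

end Gaussian

/-! ### The energy measure -/

section Growth

variable {V : Type*} [NormedAddCommGroup V] [MeasurableSpace V] [BorelSpace V]

/-- Polynomial growth of the mass of balls about the origin, at radii at least one. -/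
def HasBallGrowth (ν : Measure V) (A a : ℝ) : Prop :=
  ∀ T, 1 ≤ T → ν (Metric.closedBall 0 T) ≤ ENNReal.ofReal (A * T ^ a)

lemma lintegral_Ioc_ofReal_rpow {p S : ℝ} (hp : -1 < p) (hS : 0 ≤ S) :
    ∫⁻ u in Set.Ioc 0 S, ENNReal.ofReal (u ^ p) = ENNReal.ofReal (S ^ (p + 1) / (p + 1)) := by
  have hint : IntegrableOn (fun u : ℝ => u ^ p) (Set.Ioc 0 S) :=
    (intervalIntegrable_iff_integrableOn_Ioc_of_le hS).mp
      (intervalIntegral.intervalIntegrable_rpow' hp)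
  rw [← ofReal_integral_eq_lintegral_ofReal hint, ← intervalIntegral.integral_of_le hS,
    integral_rpow (Or.inl hp), Real.zero_rpow (by linarith), sub_zero]
  filter_upwards [ae_restrict_mem measurableSet_Ioc] with u hu using Real.rpow_nonneg hu.1.le p

lemma HasBallGrowth.restrict_compl_closedBall_le {ν : Measure V} {A a R u : ℝ}
    (hν : HasBallGrowth ν A a) (hR : 1 ≤ R) (hu : 0 < u) :
    ν.restrict (Metric.closedBall 0 R)ᶜ {ξ | u ≤ ‖ξ‖⁻¹} ≤
      (Set.Ioc 0 R⁻¹).indicator (fun u => ENNReal.ofReal (A * u ^ (-a))) u := by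
  rw [Measure.restrict_apply (measurableSet_le (by fun_prop) (by fun_prop))]
  rcases le_or_gt u R⁻¹ with huR | huR
  · have hsub : {ξ : V | u ≤ ‖ξ‖⁻¹} ∩ (Metric.closedBall 0 R)ᶜ ⊆ Metric.closedBall 0 u⁻¹ :=
      fun ξ hξ => mem_closedBall_zero_iff.mpr (le_inv_of_le_inv₀ hu hξ.1)
    rw [Set.indicator_of_mem (show u ∈ Set.Ioc 0 R⁻¹ from ⟨hu, huR⟩), Real.rpow_neg hu.le,
      ← Real.inv_rpow hu.le]
    exact (measure_mono hsub).trans (hν u⁻¹ (hR.trans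
      (le_inv_of_le_inv₀ hu huR)))
  · have hempty : {ξ : V | u ≤ ‖ξ‖⁻¹} ∩ (Metric.closedBall 0 R)ᶜ = ∅ := by
      refine Set.eq_empty_of_forall_notMem fun ξ hξ => ?_
      have hξR : R < ‖ξ‖ := by simpa using hξ.2
      exact (hξ.1.trans (inv_anti₀ (one_pos.trans_le hR) hξR.le)).not_gt huR
    rw [hempty, measure_empty]
    exact zero_le

/-- The layer cake formula for `‖ξ‖⁻¹`, whose superlevel sets are balls. -/
lemma HasBallGrowth.lintegral_compl_closedBall_le {ν : Measure V} {A a α R : ℝ}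
    (hν : HasBallGrowth ν A a) (hα : 0 < α) (ha : a < α) (hR : 1 ≤ R) :
    ∫⁻ ξ in (Metric.closedBall 0 R)ᶜ, ENNReal.ofReal (‖ξ‖⁻¹ ^ α) ∂ν ≤
      ENNReal.ofReal (α / (α - a) * A * R ^ (a - α)) := by
  have hR0 : 0 < R := one_pos.trans_le hR
  have hlevel (u : ℝ) (hu : u ∈ Set.Ioi 0) :
      ν.restrict (Metric.closedBall 0 R)ᶜ {ξ | u ≤ ‖ξ‖⁻¹} * ENNReal.ofReal (u ^ (α - 1)) ≤
        (Set.Ioc 0 R⁻¹).indicator (fun u => ENNReal.ofReal A * ENNReal.ofReal (u ^ (α - a - 1)))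
          u := by
    have hu0 : 0 < u := hu
    grw [hν.restrict_compl_closedBall_le hR hu0, ← Set.indicator_mul_const]
    refine Set.indicator_le_indicator (le_of_eq ?_)
    rw [ENNReal.ofReal_mul' (by positivity), mul_assoc, ← ENNReal.ofReal_mul (by positivity),
      ← Real.rpow_add hu0]
    ring_nf
  calc ∫⁻ ξ in (Metric.closedBall 0 R)ᶜ, ENNReal.ofReal (‖ξ‖⁻¹ ^ α) ∂ν
      = ENNReal.ofReal α * ∫⁻ u in Set.Ioi 0, ν.restrict (Metric.closedBall 0 R)ᶜ
          {ξ | u ≤ ‖ξ‖⁻¹} * ENNReal.ofReal (u ^ (α - 1)) :=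
        lintegral_rpow_eq_lintegral_meas_le_mul _ (Eventually.of_forall fun ξ => by simp)
          (by fun_prop) hα
    _ ≤ ENNReal.ofReal α * ∫⁻ u, (Set.Ioc 0 R⁻¹).indicator
          (fun u => ENNReal.ofReal A * ENNReal.ofReal (u ^ (α - a - 1))) u := by
        grw [setLIntegral_mono' measurableSet_Ioi hlevel, setLIntegral_le_lintegral]
    _ = ENNReal.ofReal (α / (α - a) * A * R ^ (a - α)) := by
        have hpos : 0 ≤ R⁻¹ ^ (α - a) / (α - a) := div_nonneg (by positivity) (by linarith)
        rw [lintegral_indicator measurableSet_Ioc, lintegral_const_mul _ (by fun_prop),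
          lintegral_Ioc_ofReal_rpow (by linarith) (by positivity), sub_add_cancel,
          ← ENNReal.ofReal_mul' hpos, ← ENNReal.ofReal_mul hα.le, Real.inv_rpow hR0.le,
          ← Real.rpow_neg hR0.le, neg_sub]
        congr 1; ring

lemma HasBallGrowth.lintegral_exp_neg_norm_sq_le {ν : Measure V} {A a T : ℝ}
    (hν : HasBallGrowth ν A a) (hA : 0 ≤ A) (ha : a ≤ 1) (hT : 1 ≤ T) :
    ∫⁻ ξ, ENNReal.ofReal (Real.exp (-(T ^ 2)⁻¹ * ‖ξ‖ ^ 2)) ∂ν ≤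
      ENNReal.ofReal (3 * A * T ^ a) := by
  have hT0 : 0 < T := one_pos.trans_le hT
  have hexp_le (ξ : V) (hξ : ξ ∈ (Metric.closedBall 0 T)ᶜ) :
      ENNReal.ofReal (Real.exp (-(T ^ 2)⁻¹ * ‖ξ‖ ^ 2)) ≤
        ENNReal.ofReal (T ^ 2) * ENNReal.ofReal (‖ξ‖⁻¹ ^ (2 : ℝ)) := by
    have hξ0 : 0 < ‖ξ‖ := hT0.trans (by simpa using hξ)
    rw [← ENNReal.ofReal_mul (sq_nonneg T), neg_mul, Real.exp_neg, Real.rpow_two, inv_pow,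
      ← div_eq_mul_inv, ← inv_div, div_eq_inv_mul]
    exact ENNReal.ofReal_le_ofReal (inv_anti₀ (by positivity)
      ((lt_add_one _).le.trans (Real.add_one_le_exp _)))
  rw [← lintegral_add_compl _ (Metric.isClosed_closedBall (x := (0 : V)) (ε := T)).measurableSet]
  calc _ ≤ ν (Metric.closedBall 0 T) +
        ∫⁻ ξ in (Metric.closedBall 0 T)ᶜ,
          ENNReal.ofReal (T ^ 2) * ENNReal.ofReal (‖ξ‖⁻¹ ^ (2 : ℝ)) ∂ν := by
        refine add_le_add ?_ (setLIntegral_mono'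
          Metric.isClosed_closedBall.measurableSet.compl hexp_le)
        rw [← setLIntegral_one]
        refine lintegral_mono fun ξ => ENNReal.ofReal_le_one.mpr (Real.exp_le_one_iff.mpr ?_)
        rw [neg_mul]
        exact neg_nonpos.mpr (by positivity)
    _ ≤ ENNReal.ofReal (A * T ^ a) +
        ENNReal.ofReal (T ^ 2) * ENNReal.ofReal (2 / (2 - a) * A * T ^ (a - 2)) := by
        rw [lintegral_const_mul _ (by fun_prop)]
        gcongr
        exacts [hν T hT, hν.lintegral_compl_closedBall_le two_pos (by linarith) hT]
    _ = ENNReal.ofReal ((1 + 2 / (2 - a)) * A * T ^ a) := by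
        have : 0 < 2 - a := by linarith
        rw [← ENNReal.ofReal_mul (by positivity), ← ENNReal.ofReal_add (by positivity)
          (by positivity), Real.rpow_sub hT0, Real.rpow_two]
        congr 1; field_simp
    _ ≤ ENNReal.ofReal (3 * A * T ^ a) := by
        gcongr
        rw [← le_sub_iff_add_le', div_le_iff₀] <;> linarith

end Growth

section Energy

open scoped Pointwise

variable {V : Type*} [NormedAddCommGroup V] [InnerProductSpace ℝ V] [FiniteDimensional ℝ V]
  [MeasurableSpace V] [BorelSpace V] {μ μ' : Measure V}

/-- The energy distribution `|μ̂(ξ)|² dξ` of a measure `μ` over frequency space. -/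
noncomputable def energyMeasure (μ : Measure V) : Measure V :=
  volume.withDensity fun ξ => ENNReal.ofReal (‖charFun μ ξ‖ ^ 2)

lemma lintegral_energyMeasure [IsFiniteMeasure μ] {f : V → ENNReal} (hf : Measurable f) :
    ∫⁻ ξ, f ξ ∂energyMeasure μ = ∫⁻ ξ, ENNReal.ofReal (‖charFun μ ξ‖ ^ 2) * f ξ :=
  lintegral_withDensity_eq_lintegral_mul _ (by fun_prop) hf

lemma integral_energyMeasure {F : Type*} [NormedAddCommGroup F] [NormedSpace ℝ F]
    [IsFiniteMeasure μ] (f : V → F) :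
    ∫ ξ, f ξ ∂energyMeasure μ = ∫ ξ, ‖charFun μ ξ‖ ^ 2 • f ξ := by
  rw [energyMeasure, integral_withDensity_eq_integral_toReal_smul (by fun_prop)
    (Eventually.of_forall fun ξ => ENNReal.ofReal_lt_top)]
  simp only [ENNReal.toReal_ofReal (sq_nonneg _)]

lemma integrable_energyMeasure_iff {F : Type*} [NormedAddCommGroup F] [NormedSpace ℝ F]
    [IsFiniteMeasure μ] {f : V → F} :
    Integrable f (energyMeasure μ) ↔ Integrable fun ξ => ‖charFun μ ξ‖ ^ 2 • f ξ := by
  rw [energyMeasure, integrable_withDensity_iff_integrable_smul' (by fun_prop)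
    (Eventually.of_forall fun ξ => ENNReal.ofReal_lt_top)]
  simp only [ENNReal.toReal_ofReal (sq_nonneg _)]

instance [IsFiniteMeasure μ] : IsLocallyFiniteMeasure (energyMeasure μ) :=
  IsLocallyFiniteMeasure.withDensity_ofReal (continuous_charFun.norm.pow 2)

lemma lintegral_exp_neg_mul_norm_sq_energyMeasure_mono [IsFiniteMeasure μ] [IsFiniteMeasure μ']
    (h : μ' ≤ μ) {b : ℝ} (hb : 0 < b) :
    ∫⁻ ξ, ENNReal.ofReal (Real.exp (-b * ‖ξ‖ ^ 2)) ∂energyMeasure μ' ≤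
      ∫⁻ ξ, ENNReal.ofReal (Real.exp (-b * ‖ξ‖ ^ 2)) ∂energyMeasure μ := by
  have hreal (ρ : Measure V) [IsFiniteMeasure ρ] :
      ∫⁻ ξ, ENNReal.ofReal (Real.exp (-b * ‖ξ‖ ^ 2)) ∂energyMeasure ρ =
        ENNReal.ofReal (∫ ξ : V, Real.exp (-b * ‖ξ‖ ^ 2) * ‖charFun ρ ξ‖ ^ 2) := by
    rw [lintegral_energyMeasure (by fun_prop), ofReal_integral_eq_lintegral_ofReal]
    · refine lintegral_congr fun ξ => ?_
      rw [← ENNReal.ofReal_mul (sq_nonneg _), mul_comm]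
    · refine (integrable_exp_neg_mul_norm_sq hb).mul_bdd (c := ρ.real Set.univ ^ 2)
        (by fun_prop) (Eventually.of_forall fun ξ => ?_)
      rw [norm_pow, norm_norm]
      exact pow_le_pow_left₀ (norm_nonneg _) (norm_charFun_le ξ) 2
    · exact Eventually.of_forall fun ξ => by positivity
  rw [hreal, hreal]
  exact ENNReal.ofReal_le_ofReal (integral_exp_neg_mul_norm_sq_mul_norm_charFun_sq_mono h hb)

lemma HasBallGrowth.energyMeasure_of_le [IsFiniteMeasure μ] [IsFiniteMeasure μ'] {A a : ℝ}
    (h : HasBallGrowth (energyMeasure μ) A a) (hA : 0 ≤ A) (ha : a ≤ 1) (hle : μ' ≤ μ) :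
    HasBallGrowth (energyMeasure μ') (9 * A) a := by
  intro T hT
  have : 0 < T := one_pos.trans_le hT
  have hone_le (ξ : V) (hξ : ξ ∈ Metric.closedBall 0 T) :
      1 ≤ ENNReal.ofReal 3 * ENNReal.ofReal (Real.exp (-(T ^ 2)⁻¹ * ‖ξ‖ ^ 2)) := by
    have hexp : -1 ≤ -(T ^ 2)⁻¹ * ‖ξ‖ ^ 2 := by
      rw [neg_mul, neg_le_neg_iff, inv_mul_le_one₀ (by positivity)]
      gcongr
      exact mem_closedBall_zero_iff.mp hξ
    have hthree : 1 ≤ 3 * Real.exp (-1) := by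
      rw [Real.exp_neg, ← div_eq_mul_inv, one_le_div (Real.exp_pos _)]
      exact Real.exp_one_lt_three.le
    rw [← ENNReal.ofReal_mul (by norm_num), ENNReal.one_le_ofReal]
    exact hthree.trans (by gcongr)
  calc energyMeasure μ' (Metric.closedBall 0 T)
      ≤ ∫⁻ ξ, ENNReal.ofReal 3 * ENNReal.ofReal (Real.exp (-(T ^ 2)⁻¹ * ‖ξ‖ ^ 2))
          ∂energyMeasure μ' := by
        rw [← setLIntegral_one]
        exact (setLIntegral_mono' Metric.isClosed_closedBall.measurableSet hone_le).trans
          (setLIntegral_le_lintegral _ _)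
    _ ≤ ENNReal.ofReal 3 * ENNReal.ofReal (3 * A * T ^ a) := by
        rw [lintegral_const_mul _ (by fun_prop)]
        grw [lintegral_exp_neg_mul_norm_sq_energyMeasure_mono hle (by positivity),
          h.lintegral_exp_neg_norm_sq_le hA ha hT]
    _ = ENNReal.ofReal (9 * A * T ^ a) := by
        rw [← ENNReal.ofReal_mul (by norm_num)]
        congr 1; ring

/-- The spherical average of `|μ̂|²` is the Fourier transform of the law of `x - y + t u` with
`u` on the unit sphere, and this law gives no mass to a neighbourhood of the origin. -/
theorem integral_charFun_smul_energyMeasure_eq_zero {σ : Measure V} [IsFiniteMeasure μ]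
    [IsFiniteMeasure σ] {K : Set V} (hK : IsCompact K) (hμ : ∀ᵐ x ∂μ, x ∈ K)
    (hσ : ∀ᵐ u ∂σ, ‖u‖ = 1) {t : ℝ} (ht : 0 ≤ t) (htK : ∀ x ∈ K, ∀ y ∈ K, ‖x - y‖ ≠ t)
    (hint : Integrable (fun ξ => charFun σ (t • ξ)) (energyMeasure μ)) :
    ∫ ξ, charFun σ (t • ξ) ∂energyMeasure μ = 0 := by
  have hcompact : IsCompact (K - K) := by rw [sub_eq_add_neg]; exact hK.add hK.neg
  obtain ⟨η, hη, hsep⟩ := exists_pos_le_abs_norm_sub hcompact (t := t) <| by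
    rintro _ ⟨x, hx, y, hy, rfl⟩
    exact htK x hx y hy
  have hcharFun : charFun (differenceLaw μ ∗ σ.map (t • ·)) =
      fun ξ => ‖charFun μ ξ‖ ^ 2 • charFun σ (t • ξ) := by
    ext ξ
    rw [charFun_conv, charFun_differenceLaw, charFun_map_smul, Complex.real_smul]
  have hsphere : ∀ᵐ w ∂σ.map (t • ·), ‖w‖ = t := by
    rw [ae_map_iff (by fun_prop) (measurableSet_eq_fun (by fun_prop) (by fun_prop))]
    filter_upwards [hσ] with u hu
    rw [norm_smul, hu, mul_one, Real.norm_of_nonneg ht]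
  have hfar : ∀ᵐ z ∂(differenceLaw μ ∗ σ.map (t • ·)), η ≤ ‖z‖ := by
    refine ae_conv (measurableSet_le (by fun_prop) (by fun_prop))
      (ae_differenceLaw_mem_sub hK hμ) hsphere fun z w hz hw => (hsep z hz).trans ?_
    have := abs_norm_sub_norm_le z (-w)
    rwa [norm_neg, sub_neg_eq_add, hw] at this
  rw [integral_energyMeasure, ← hcharFun]
  rw [integrable_energyMeasure_iff, ← hcharFun] at hint
  exact integral_charFun_eq_zero_of_ae_le_norm hη hfar hint

end Energy

/-! ### Missing distances -/

lemma HasFourierDecay.lintegral_compl_closedBall_enorm_charFun_smul_le {V : Type*}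
    [NormedAddCommGroup V] [InnerProductSpace ℝ V] [MeasurableSpace V] [BorelSpace V]
    {σ ν : Measure V} {α A B M a t : ℝ}
    (hσ : HasFourierDecay σ α B) (hν : HasBallGrowth ν A a) (hα : 0 < α) (ha : a ≤ α / 2)
    (hA : 0 ≤ A) (ht : 0 < t) (ht1 : t ≤ 1) (hM : 1 ≤ M) :
    ∫⁻ ξ in (Metric.closedBall 0 (M / t))ᶜ, ‖charFun σ (t • ξ)‖ₑ ∂ν ≤
      ENNReal.ofReal (2 * A * B * M ^ (-(α / 2)) * (1 / t) ^ a) := by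
  have hB : 0 ≤ B := hσ.nonneg
  have hR : 1 ≤ M / t := (one_le_div ht).mpr (ht1.trans hM)
  have hM0 : 0 < M := one_pos.trans_le hM
  have hpt (ξ : V) (hξ : ξ ∈ (Metric.closedBall 0 (M / t))ᶜ) :
      ‖charFun σ (t • ξ)‖ₑ ≤ ENNReal.ofReal (B * t ^ (-α)) * ENNReal.ofReal (‖ξ‖⁻¹ ^ α) := by
    have hξ0 : ξ ≠ 0 := by
      rintro rfl
      exact hξ (Metric.mem_closedBall_self (by positivity))
    rw [← ofReal_norm, ← ENNReal.ofReal_mul (by positivity)]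
    exact ENNReal.ofReal_le_ofReal (hσ.norm_charFun_smul_le ht hξ0)
  have hratio : α / (α - a) ≤ 2 := by rw [div_le_iff₀] <;> linarith
  have hscale : t ^ (-α) * (M / t) ^ (a - α) = M ^ (a - α) * (1 / t) ^ a := by
    rw [Real.div_rpow hM0.le ht.le, one_div, Real.inv_rpow ht.le, ← Real.rpow_neg ht.le,
      mul_div_left_comm, ← Real.rpow_sub ht]
    ring_nf
  calc ∫⁻ ξ in (Metric.closedBall 0 (M / t))ᶜ, ‖charFun σ (t • ξ)‖ₑ ∂ν
      ≤ ENNReal.ofReal (B * t ^ (-α)) *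
          ∫⁻ ξ in (Metric.closedBall 0 (M / t))ᶜ, ENNReal.ofReal (‖ξ‖⁻¹ ^ α) ∂ν := by
        rw [← lintegral_const_mul _ (by fun_prop)]
        exact setLIntegral_mono' Metric.isClosed_closedBall.measurableSet.compl hpt
    _ ≤ ENNReal.ofReal (B * t ^ (-α) * (α / (α - a) * A * (M / t) ^ (a - α))) := by
        rw [ENNReal.ofReal_mul (by positivity : 0 ≤ B * t ^ (-α))]
        gcongr
        exact hν.lintegral_compl_closedBall_le hα (by linarith) hR
    _ = ENNReal.ofReal (α / (α - a) * A * B * M ^ (a - α) * (1 / t) ^ a) := by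
        congr 1
        linear_combination (α / (α - a) * A * B) * hscale
    _ ≤ ENNReal.ofReal (2 * A * B * M ^ (-(α / 2)) * (1 / t) ^ a) := by
        gcongr
        linarith

section Approximation

lemma exists_seq_isCompact_tendsto_measureReal_compl {X : Type*} [TopologicalSpace X] [T2Space X]
    [MeasurableSpace X] [BorelSpace X] {μ : Measure X} [IsFiniteMeasure μ]
    [μ.InnerRegularCompactLTTop] {E : Set X} (hE : μ Eᶜ = 0) :
    ∃ K : ℕ → Set X, (∀ n, IsCompact (K n)) ∧ (∀ n, K n ⊆ E) ∧
      Tendsto (fun n => μ.real (K n)ᶜ) atTop (𝓝 0) := by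
  set F := (toMeasurable μ Eᶜ)ᶜ with hF
  have hFE : F ⊆ E := Set.compl_subset_comm.mp (subset_toMeasurable μ Eᶜ)
  have hμF : μ Fᶜ = 0 := by rw [hF, compl_compl, measure_toMeasurable, hE]
  have happrox (n : ℕ) : ∃ K ⊆ F, IsCompact K ∧ μ (F \ K) < ENNReal.ofReal (1 / (n + 1)) :=
    (measurableSet_toMeasurable μ Eᶜ).compl.exists_isCompact_sdiff_lt (measure_ne_top μ F)
      (ENNReal.ofReal_pos.mpr (by positivity)).ne'
  choose K hKF hK hμK using happrox
  refine ⟨K, hK, fun n => (hKF n).trans hFE, squeeze_zero (fun _ => measureReal_nonneg)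
    (fun n => ?_) tendsto_one_div_add_atTop_nhds_zero_nat⟩
  have hsub : (K n)ᶜ ⊆ Fᶜ ∪ F \ K n := fun x hx => by
    by_cases hxF : x ∈ F
    exacts [Or.inr ⟨hxF, hx⟩, Or.inl hxF]
  refine ENNReal.toReal_le_of_le_ofReal (by positivity) ?_
  calc μ (K n)ᶜ ≤ μ Fᶜ + μ (F \ K n) := (measure_mono hsub).trans (measure_union_le _ _)
    _ ≤ ENNReal.ofReal (1 / (n + 1)) := by rw [hμF, zero_add]; exact (hμK n).le

variable {V : Type*} [NormedAddCommGroup V] [InnerProductSpace ℝ V]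
  [MeasurableSpace V] [BorelSpace V] [SecondCountableTopology V] {μ : Measure V} {K : Set V}

lemma norm_charFun_sub_charFun_restrict_le [IsFiniteMeasure μ] (hK : MeasurableSet K) (ξ : V) :
    ‖charFun μ ξ - charFun (μ.restrict K) ξ‖ ≤ μ.real Kᶜ := by
  have hadd : charFun μ ξ = charFun (μ.restrict K) ξ + charFun (μ.restrict Kᶜ) ξ := by
    simp only [charFun_apply]
    refine (integral_add_compl hK (Integrable.of_bound (C := 1) (by fun_prop)
      (Eventually.of_forall fun x => (Complex.norm_exp_ofReal_mul_I _).le))).symm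
  rw [hadd, add_sub_cancel_left]
  exact (norm_charFun_le ξ).trans_eq (measureReal_restrict_apply_univ _)

lemma abs_norm_charFun_sq_sub_restrict_le [IsProbabilityMeasure μ] (hK : MeasurableSet K)
    (ξ : V) : |‖charFun μ ξ‖ ^ 2 - ‖charFun (μ.restrict K) ξ‖ ^ 2| ≤ 2 * μ.real Kᶜ := by
  have hK_le : ‖charFun (μ.restrict K) ξ‖ ≤ 1 :=
    (norm_charFun_le ξ).trans (by rw [measureReal_restrict_apply_univ]; exact measureReal_le_one)
  have hle : ‖charFun μ ξ‖ ≤ 1 := norm_charFun_le_one ξ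
  rw [sq_sub_sq, abs_mul, abs_of_nonneg (by positivity)]
  gcongr
  · linarith
  · exact (abs_norm_sub_norm_le _ _).trans (norm_charFun_sub_charFun_restrict_le hK ξ)

end Approximation

section Energy

variable {V : Type*} [NormedAddCommGroup V] [InnerProductSpace ℝ V] [FiniteDimensional ℝ V]
  [MeasurableSpace V] [BorelSpace V] {μ : Measure V}

lemma energyMeasure_real_apply [IsFiniteMeasure μ] (S : Set V) :
    (energyMeasure μ).real S = ∫ ξ in S, ‖charFun μ ξ‖ ^ 2 := by
  rw [measureReal_def, energyMeasure, withDensity_apply', integral_eq_lintegral_of_nonneg_ae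
    (Eventually.of_forall fun ξ => sq_nonneg _) (by fun_prop)]

lemma abs_energyMeasure_real_sub_restrict_le [IsProbabilityMeasure μ] {K S : Set V}
    (hK : MeasurableSet K) (hS : IsCompact S) :
    |(energyMeasure μ).real S - (energyMeasure (μ.restrict K)).real S| ≤
      2 * μ.real Kᶜ * volume.real S := by
  have hint (ρ : Measure V) [IsFiniteMeasure ρ] : IntegrableOn (fun ξ => ‖charFun ρ ξ‖ ^ 2) S :=
    (continuous_charFun.norm.pow 2).continuousOn.integrableOn_compact hS
  rw [energyMeasure_real_apply, energyMeasure_real_apply, ← integral_sub (hint μ) (hint _),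
    ← Real.norm_eq_abs]
  exact norm_setIntegral_le_of_norm_le_const hS.measure_lt_top fun ξ _ =>
    abs_norm_charFun_sq_sub_restrict_le hK ξ

lemma tendsto_energyMeasure_real_restrict [IsProbabilityMeasure μ] {K : ℕ → Set V} {S : Set V}
    (hK : ∀ n, MeasurableSet (K n)) (hμK : Tendsto (fun n => μ.real (K n)ᶜ) atTop (𝓝 0))
    (hS : IsCompact S) :
    Tendsto (fun n => (energyMeasure (μ.restrict (K n))).real S) atTop
      (𝓝 ((energyMeasure μ).real S)) := by
  refine tendsto_iff_dist_tendsto_zero.mpr (squeeze_zero (fun _ => dist_nonneg)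
    (fun n => ?_) (g := fun n => 2 * μ.real (K n)ᶜ * volume.real S) ?_)
  · rw [dist_comm, Real.dist_eq]
    exact abs_energyMeasure_real_sub_restrict_le (hK n) hS
  · simpa using (hμK.const_mul 2).mul_const (volume.real S)

end Energy

section Distances

variable {V : Type*} [NormedAddCommGroup V] [InnerProductSpace ℝ V] [FiniteDimensional ℝ V]
  [MeasurableSpace V] [BorelSpace V] {μ σ : Measure V}

lemma half_le_re_charFun [IsProbabilityMeasure σ] (hσ : ∀ᵐ x ∂σ, ‖x‖ = 1) {ξ : V}
    (hξ : ‖ξ‖ ≤ 1) : 1 / 2 ≤ (charFun σ ξ).re := by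
  have hint : Integrable (fun x => Complex.exp ((inner ℝ x ξ : ℝ) * Complex.I)) σ :=
    Integrable.of_bound (C := 1) (by fun_prop)
      (Eventually.of_forall fun x => (Complex.norm_exp_ofReal_mul_I _).le)
  have hre : (charFun σ ξ).re = ∫ x, Real.cos (inner ℝ x ξ) ∂σ := by
    rw [charFun_apply]
    simp only [← Complex.exp_ofReal_mul_I_re]
    exact (integral_re hint).symm
  have hhalf : ∫ _, (1 / 2 : ℝ) ∂σ = 1 / 2 := by simp
  rw [hre, ← hhalf]
  refine integral_mono_ae (integrable_const _) (by simpa using hint.re) ?_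
  filter_upwards [hσ] with x hx
  have hinner : |inner ℝ x ξ| ≤ 1 := (abs_real_inner_le_norm x ξ).trans (by rwa [hx, one_mul])
  linarith [Real.one_sub_sq_div_two_le_cos (x := inner ℝ x ξ),
    (sq_le_one_iff_abs_le_one _).mpr hinner]

lemma half_measureReal_le_of_integral_eq_zero {X : Type*} [MeasurableSpace X] {ν : Measure X}
    {φ : X → ℝ} {S T : Set X} (hS : MeasurableSet S) (hT : MeasurableSet T) (hST : S ⊆ T)
    (hνT : ν T ≠ ⊤) (hφ : Integrable φ ν) (hzero : ∫ x, φ x ∂ν = 0) (hφS : ∀ x ∈ S, 1 / 2 ≤ φ x)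
    (hφT : ∀ x ∈ T, -1 ≤ φ x) :
    ν.real S / 2 ≤ ν.real T - ν.real S + ∫ x in Tᶜ, |φ x| ∂ν := by
  have hνS : ν S ≠ ⊤ := measure_ne_top_of_subset hST hνT
  have hνTS : ν (T \ S) ≠ ⊤ := measure_ne_top_of_subset Set.sdiff_subset hνT
  have hsdiff : ν.real (T \ S) = ν.real T - ν.real S := measureReal_sdiff hST hS hνT
  have hlow : ν.real S / 2 ≤ ∫ x in S, φ x ∂ν := by
    have := setIntegral_mono_on (integrableOn_const hνS) hφ.integrableOn hS hφS
    rwa [setIntegral_const, smul_eq_mul, mul_one_div] at this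
  have hmid : -ν.real (T \ S) ≤ ∫ x in T \ S, φ x ∂ν := by
    have := setIntegral_mono_on (integrableOn_const hνTS) hφ.integrableOn (hT.diff hS)
      fun x hx => hφT x hx.1
    rwa [setIntegral_const, smul_eq_mul, mul_neg_one] at this
  have hhigh : -∫ x in Tᶜ, |φ x| ∂ν ≤ ∫ x in Tᶜ, φ x ∂ν :=
    neg_le_of_abs_le abs_integral_le_integral_abs
  have hsplitT := integral_add_compl hT hφ
  have hsplitS := setIntegral_sdiff hS hφ.integrableOn hST
  linarith

theorem half_energyMeasure_le_of_isCompact [IsFiniteMeasure μ] [IsProbabilityMeasure σ]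
    (hσ : ∀ᵐ u ∂σ, ‖u‖ = 1) {K : Set V} (hK : IsCompact K) (hμK : ∀ᵐ x ∂μ, x ∈ K)
    {α A B M a t : ℝ} (hdecay : HasFourierDecay σ α B)
    (hgrowth : HasBallGrowth (energyMeasure μ) A a) (hα : 0 < α) (ha : a ≤ α / 2) (hA : 0 ≤ A)
    (ht : 0 < t) (ht1 : t ≤ 1) (hM : 1 ≤ M)
    (htK : ∀ x ∈ K, ∀ y ∈ K, ‖x - y‖ ≠ t) :
    (energyMeasure μ).real (Metric.closedBall 0 (1 / t)) / 2 ≤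
      (energyMeasure μ).real (Metric.closedBall 0 (M / t)) -
        (energyMeasure μ).real (Metric.closedBall 0 (1 / t)) +
          2 * A * B * M ^ (-(α / 2)) * (1 / t) ^ a := by
  have hB : 0 ≤ B := hdecay.nonneg
  have hT : MeasurableSet (Metric.closedBall (0 : V) (M / t)) :=
    Metric.isClosed_closedBall.measurableSet
  have htail := hdecay.lintegral_compl_closedBall_enorm_charFun_smul_le hgrowth hα ha hA ht ht1 hM
  have hcont : Continuous fun ξ : V => charFun σ (t • ξ) :=
    continuous_charFun.comp (continuous_const_smul t)
  have hint : Integrable (fun ξ => charFun σ (t • ξ)) (energyMeasure μ) := by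
    rw [← integrableOn_univ, ← Set.union_compl_self (Metric.closedBall (0 : V) (M / t))]
    exact (hcont.continuousOn.integrableOn_compact (isCompact_closedBall _ _)).union
      ⟨hcont.aestronglyMeasurable, htail.trans_lt ENNReal.ofReal_lt_top⟩
  have hzero : ∫ ξ, charFun σ (t • ξ) ∂energyMeasure μ = 0 :=
    integral_charFun_smul_energyMeasure_eq_zero hK hμK hσ ht.le htK hint
  refine (half_measureReal_le_of_integral_eq_zero Metric.isClosed_closedBall.measurableSet hT
    (Metric.closedBall_subset_closedBall (by gcongr)) measure_closedBall_lt_top.ne hint.re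
    ((integral_re hint).trans (by simp [hzero])) (fun ξ hξ => ?_) fun ξ _ => ?_).trans ?_
  · refine half_le_re_charFun hσ ?_
    rw [norm_smul, Real.norm_of_nonneg ht.le, mul_comm, ← le_div_iff₀ ht]
    exact mem_closedBall_zero_iff.mp hξ
  · exact neg_le_of_abs_le ((Complex.abs_re_le_norm _).trans (norm_charFun_le_one _))
  · gcongr
    calc ∫ ξ in (Metric.closedBall 0 (M / t))ᶜ, |(charFun σ (t • ξ)).re| ∂energyMeasure μ
        ≤ ∫ ξ in (Metric.closedBall 0 (M / t))ᶜ, ‖charFun σ (t • ξ)‖ ∂energyMeasure μ :=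
          integral_mono hint.re.abs.integrableOn hint.norm.integrableOn
            fun ξ => Complex.abs_re_le_norm _
      _ ≤ 2 * A * B * M ^ (-(α / 2)) * (1 / t) ^ a := by
          rw [integral_norm_eq_lintegral_enorm hcont.aestronglyMeasurable]
          exact ENNReal.toReal_le_of_le_ofReal (by positivity) htail

theorem half_energyMeasure_le_of_forall_norm_sub_ne [IsProbabilityMeasure μ]
    [IsProbabilityMeasure σ] (hσ : ∀ᵐ u ∂σ, ‖u‖ = 1) {E : Set V} (hμE : μ Eᶜ = 0)
    {α A B M a t : ℝ} (hdecay : HasFourierDecay σ α B)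
    (hgrowth : HasBallGrowth (energyMeasure μ) A a) (hα : 0 < α) (ha : a ≤ α / 2) (ha1 : a ≤ 1)
    (hA : 0 ≤ A) (ht : 0 < t) (ht1 : t ≤ 1) (hM : 1 ≤ M)
    (htE : ∀ x ∈ E, ∀ y ∈ E, ‖x - y‖ ≠ t) :
    (energyMeasure μ).real (Metric.closedBall 0 (1 / t)) / 2 ≤
      (energyMeasure μ).real (Metric.closedBall 0 (M / t)) -
        (energyMeasure μ).real (Metric.closedBall 0 (1 / t)) +
          18 * A * B * M ^ (-(α / 2)) * (1 / t) ^ a := by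
  obtain ⟨K, hK, hKE, hμK⟩ := exists_seq_isCompact_tendsto_measureReal_compl hμE
  have hlim (R : ℝ) := tendsto_energyMeasure_real_restrict (fun n => (hK n).measurableSet) hμK
    (isCompact_closedBall (0 : V) R)
  refine le_of_tendsto_of_tendsto' ((hlim (1 / t)).div_const 2)
    (((hlim (M / t)).sub (hlim (1 / t))).add_const _) fun n => ?_
  refine (half_energyMeasure_le_of_isCompact hσ (hK n) (ae_restrict_mem (hK n).measurableSet)
    hdecay (hgrowth.energyMeasure_of_le hA ha1 Measure.restrict_le_self) hα ha (by positivity) ht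
    ht1 hM fun x hx y hy => htE x (hKE n hx) y (hKE n hy)).trans_eq ?_
  ring

end Distances

section PartialFourierIntegral

variable {d : ℕ} {μ : Measure (EuclideanSpace ℝ (Fin d))}

lemma norm_fourierMeasure (μ : Measure (EuclideanSpace ℝ (Fin d)))
    (ξ : EuclideanSpace ℝ (Fin d)) : ‖fourierMeasure μ ξ‖ = ‖charFun μ ξ‖ := by
  have h : fourierMeasure μ ξ = charFun μ (-ξ) := by
    simp only [fourierMeasure, charFun_apply, inner_neg_right, Complex.ofReal_neg, neg_mul,
      mul_comm Complex.I]
  rw [h, charFun_neg, RCLike.norm_conj]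

lemma partialFourierIntegral_eq [IsFiniteMeasure μ] (T : ℝ) :
    partialFourierIntegral μ T = (energyMeasure μ).real (Metric.closedBall 0 T) := by
  simp only [partialFourierIntegral, norm_fourierMeasure, energyMeasure_real_apply]

lemma partialFourierIntegral_nonneg (T : ℝ) : 0 ≤ partialFourierIntegral μ T :=
  integral_nonneg fun _ => sq_nonneg _

lemma monotone_partialFourierIntegral [IsFiniteMeasure μ] :
    Monotone (partialFourierIntegral μ) := by
  intro S T hST
  rw [partialFourierIntegral_eq, partialFourierIntegral_eq]
  exact measureReal_mono (Metric.closedBall_subset_closedBall hST) measure_closedBall_lt_top.ne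

lemma hasBallGrowth_energyMeasure [IsFiniteMeasure μ] {A a : ℝ}
    (hF : ∀ T, 1 ≤ T → partialFourierIntegral μ T ≤ A * T ^ a) :
    HasBallGrowth (energyMeasure μ) A a := by
  intro T hT
  rw [← ofReal_measureReal measure_closedBall_lt_top.ne, ← partialFourierIntegral_eq]
  exact ENNReal.ofReal_le_ofReal (hF T hT)

theorem mem_distanceSet_of_partialFourierIntegral_sub_le [IsProbabilityMeasure μ]
    {σ : Measure (EuclideanSpace ℝ (Fin d))} [IsProbabilityMeasure σ] (hσ : ∀ᵐ u ∂σ, ‖u‖ = 1)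
    {E : Set (EuclideanSpace ℝ (Fin d))} (hμE : μ Eᶜ = 0) {α A B M a c t : ℝ}
    (hdecay : HasFourierDecay σ α B) (hgrowth : HasBallGrowth (energyMeasure μ) A a) (hα : 0 < α)
    (ha : a ≤ α / 2) (ha1 : a ≤ 1) (hA : 0 ≤ A) (ht : t ∈ Set.Ioc 0 1) (hM : 1 ≤ M)
    (hMc : 18 * A * B * M ^ (-(α / 2)) < c)
    (hlow : 4 * c * (1 / t) ^ a ≤ partialFourierIntegral μ (1 / t))
    (hmid : partialFourierIntegral μ (M / t) - partialFourierIntegral μ (1 / t) ≤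
      c * (1 / t) ^ a) :
    t ∈ distanceSet E := by
  by_contra htE
  have hne (x) (hx : x ∈ E) (y) (hy : y ∈ E) : ‖x - y‖ ≠ t :=
    fun hxy => htE ⟨x, hx, y, hy, hxy⟩
  have henergy := half_energyMeasure_le_of_forall_norm_sub_ne hσ hμE hdecay hgrowth hα ha ha1 hA
    ht.1 ht.2 hM hne
  have htail := mul_lt_mul_of_pos_right hMc (Real.rpow_pos_of_pos (one_div_pos.mpr ht.1) a)
  rw [← partialFourierIntegral_eq, ← partialFourierIntegral_eq] at henergy
  linarith

end PartialFourierIntegral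

/-! ### Lacunary sequences -/

section Lacunary

lemma exists_sub_lt_of_sub_lt_mul {F : ℝ → ℝ} (hF : Monotone F) {S R : ℕ → ℝ} {L : ℕ} {δ : ℝ}
    (hRS : ∀ l < L, R l ≤ S (l + 1)) (hδ : F (S L) - F (S 0) < L * δ) :
    ∃ l < L, F (R l) - F (S l) < δ := by
  by_contra! hlarge
  have hsum : L * δ ≤ ∑ l ∈ Finset.range L, (F (S (l + 1)) - F (S l)) := by
    simpa using Finset.card_nsmul_le_sum (Finset.range L) _ δ fun l hl =>
      have hl := Finset.mem_range.mp hl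
      (hlarge l hl).trans (sub_le_sub_right (hF (hRS l hl)) _)
  rw [Finset.sum_range_sub fun l => F (S l)] at hsum
  exact hδ.not_ge hsum

variable {τ₁ τ₂ : ℝ} {J : ℕ} {t : ℕ → ℝ}

lemma IsLacunary.mem_Ioc (ht : IsLacunary τ₁ τ₂ J t) {j : ℕ} (hj : j ∈ Set.Icc 1 J) :
    t j ∈ Set.Ioc 0 1 :=
  ht.1 j hj.1 (mod_cast hj.2)

lemma IsLacunary.mul_le_succ (ht : IsLacunary τ₁ τ₂ J t) {j : ℕ} (hj : 1 ≤ j) (hjJ : j + 1 ≤ J) :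
    τ₁ * t j ≤ t (j + 1) :=
  (le_div_iff₀ (ht.mem_Ioc ⟨hj, by omega⟩).1).mp (ht.2 j hj (mod_cast hjJ)).1

lemma IsLacunary.succ_le_mul (ht : IsLacunary τ₁ τ₂ J t) {j : ℕ} (hj : 1 ≤ j) (hjJ : j + 1 ≤ J) :
    t (j + 1) ≤ τ₂ * t j :=
  (div_le_iff₀ (ht.mem_Ioc ⟨hj, by omega⟩).1).mp (ht.2 j hj (mod_cast hjJ)).2

lemma IsLacunary.pow_mul_le (ht : IsLacunary τ₁ τ₂ J t) (hτ₁ : 0 ≤ τ₁) {j n : ℕ} (hj : 1 ≤ j)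
    (hn : j + n ≤ J) : τ₁ ^ n * t j ≤ t (j + n) := by
  induction n with
  | zero => simp
  | succ n ih =>
    calc τ₁ ^ (n + 1) * t j = τ₁ * (τ₁ ^ n * t j) := by ring
      _ ≤ τ₁ * t (j + n) := by gcongr; exact ih (by omega)
      _ ≤ t (j + (n + 1)) := ht.mul_le_succ (by omega) hn

lemma IsLacunary.le_pow_mul (ht : IsLacunary τ₁ τ₂ J t) (hτ₂ : 0 ≤ τ₂) {j n : ℕ} (hj : 1 ≤ j)
    (hn : j + n ≤ J) : t (j + n) ≤ τ₂ ^ n * t j := by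
  induction n with
  | zero => simp
  | succ n ih =>
    calc t (j + (n + 1)) ≤ τ₂ * t (j + n) := ht.succ_le_mul (j := j + n) (by omega) hn
      _ ≤ τ₂ * (τ₂ ^ n * t j) := by gcongr; exact ih (by omega)
      _ = τ₂ ^ (n + 1) * t j := by ring

lemma IsLacunary.shift (ht : IsLacunary τ₁ τ₂ ⊤ t) (k J : ℕ) :
    IsLacunary τ₁ τ₂ J fun j => t (k + j) :=
  ⟨fun j hj _ => ht.1 (k + j) (by omega) le_top,
    fun j hj _ => ht.2 (k + j) (by omega) le_top⟩

lemma IsLacunary.mul_one_div_rpow_le (ht : IsLacunary τ₁ τ₂ J t) (hτ₁ : 0 < τ₁) (hτ₁' : τ₁ ≤ 1)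
    {a : ℝ} (ha : 0 ≤ a) {j n : ℕ} (hj : 1 ≤ j) (hn : j + n ≤ J) (hna : n * a ≤ 1) :
    τ₁ * (1 / t (j + n)) ^ a ≤ (1 / t j) ^ a := by
  have htj : 0 < t j := (ht.mem_Ioc ⟨hj, Nat.le_of_add_right_le hn⟩).1
  have htn : 0 < t (j + n) := (ht.mem_Ioc ⟨by omega, hn⟩).1
  have hpow : τ₁ ≤ (τ₁ ^ n) ^ a := by
    rw [← Real.rpow_natCast, ← Real.rpow_mul hτ₁.le]
    exact Real.self_le_rpow_of_le_one hτ₁.le hτ₁' hna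
  calc τ₁ * (1 / t (j + n)) ^ a ≤ (τ₁ ^ n) ^ a * (1 / t (j + n)) ^ a := by gcongr
    _ = (τ₁ ^ n / t (j + n)) ^ a := by
      rw [← Real.mul_rpow (by positivity) (by positivity), mul_one_div]
    _ ≤ (1 / t j) ^ a := by
      gcongr ?_ ^ a
      rw [div_le_div_iff₀ htn htj, one_mul]
      exact ht.pow_mul_le hτ₁.le hj hn

lemma IsLacunary.exists_sub_lt {C M c a : ℝ} {N L : ℕ} {F : ℝ → ℝ}
    (ht : IsLacunary τ₁ τ₂ (L * N + 1 : ℕ) t) (hτ₁ : 0 < τ₁) (hτ₁' : τ₁ ≤ 1) (hτ₂ : 0 ≤ τ₂)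
    (hM : 0 < M) (hN : τ₂ ^ N ≤ M⁻¹) (hc : 0 ≤ c) (ha : 0 ≤ a) (hL : C < L * (c * τ₁))
    (haNL : (L * N : ℕ) * a ≤ 1) (hF : Monotone F) (hF0 : ∀ T, 0 ≤ F T)
    (hFC : ∀ T, 1 ≤ T → F T ≤ C * T ^ a) :
    ∃ j ∈ Set.Icc 1 (L * N + 1), F (M / t j) - F (1 / t j) < c * (1 / t j) ^ a := by
  have hindex {l : ℕ} (hl : l ≤ L) : 1 + l * N ∈ Set.Icc 1 (L * N + 1) :=
    ⟨by omega, by have := Nat.mul_le_mul_right N hl; omega⟩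
  have hlast := ht.mem_Ioc (hindex le_rfl)
  have hstep (l : ℕ) (hl : l < L) : M / t (1 + l * N) ≤ 1 / t (1 + (l + 1) * N) := by
    have hadd : 1 + (l + 1) * N = 1 + l * N + N := by ring
    have htl : 0 < t (1 + l * N) := (ht.mem_Ioc (hindex hl.le)).1
    have hle : t (1 + (l + 1) * N) ≤ M⁻¹ * t (1 + l * N) := by
      have := ht.le_pow_mul hτ₂ (j := 1 + l * N) (n := N) (by omega) (hadd ▸ (hindex hl).2)
      rw [hadd]
      exact this.trans (by gcongr)
    rw [div_le_div_iff₀ htl (ht.mem_Ioc (hindex hl)).1, one_mul]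
    exact (le_inv_mul_iff₀ hM).mp hle
  have htotal : F (1 / t (1 + L * N)) - F (1 / t (1 + 0 * N)) <
      L * (c * (τ₁ * (1 / t (1 + L * N)) ^ a)) := by
    have hpos := Real.rpow_pos_of_pos (one_div_pos.mpr hlast.1) a
    calc F (1 / t (1 + L * N)) - F (1 / t (1 + 0 * N)) ≤ F (1 / t (1 + L * N)) :=
          sub_le_self _ (hF0 _)
      _ ≤ C * (1 / t (1 + L * N)) ^ a := hFC _ ((one_le_div hlast.1).mpr hlast.2)
      _ < L * (c * τ₁) * (1 / t (1 + L * N)) ^ a := by gcongr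
      _ = L * (c * (τ₁ * (1 / t (1 + L * N)) ^ a)) := by ring
  obtain ⟨l, hl, hincr⟩ :=
    exists_sub_lt_of_sub_lt_mul (S := fun l => 1 / t (1 + l * N)) hF hstep htotal
  refine ⟨1 + l * N, hindex hl.le, hincr.trans_le ?_⟩
  have hadd : 1 + L * N = 1 + l * N + (L - l) * N := by
    rw [add_assoc, ← add_mul, Nat.add_sub_of_le hl.le]
  rw [hadd]
  gcongr
  refine ht.mul_one_div_rpow_le hτ₁ hτ₁' ha (by omega) (hadd ▸ (hindex le_rfl).2)
    (le_trans ?_ haNL)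
  gcongr
  omega

end Lacunary

lemma exists_index_mem_distanceSet {d : ℕ} (hd : 2 ≤ d) {C₀ : ℝ} (hC₀ : 0 < C₀) {τ₁ τ₂ : ℝ}
    (hτ₁ : 0 < τ₁) (hτ : τ₁ ≤ τ₂) (hτ₂ : τ₂ < 1) :
    ∃ n : ℕ, ∀ a : ℝ, 0 ≤ a → a * (n + 4) ≤ 1 →
      ∀ (E : Set (EuclideanSpace ℝ (Fin d))) (μ : Measure (EuclideanSpace ℝ (Fin d))),
        IsProbabilityMeasure μ → μ Eᶜ = 0 →
        (∀ T : ℝ, 1 ≤ T → C₀⁻¹ * T ^ a ≤ partialFourierIntegral μ T ∧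
          partialFourierIntegral μ T ≤ C₀ * T ^ a) →
        ∀ t : ℕ → ℝ, IsLacunary τ₁ τ₂ (n + 1 : ℕ) t →
          ∃ j ∈ Set.Icc 1 (n + 1), t j ∈ distanceSet E := by
  obtain ⟨σ, _, hσ, B, hB⟩ :=
    exists_sphere_law_hasFourierDecay (V := EuclideanSpace ℝ (Fin d)) (by simpa using hd)
  have hc : 0 < C₀⁻¹ / 4 := by positivity
  obtain ⟨M, hM, hMB⟩ : ∃ M : ℝ, 1 ≤ M ∧ 18 * C₀ * B * M ^ (-(1 / 2 / 2) : ℝ) < C₀⁻¹ / 4 := by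
    have h := (tendsto_rpow_neg_atTop (show (0 : ℝ) < 1 / 2 / 2 by norm_num)).const_mul
      (18 * C₀ * B)
    rw [mul_zero] at h
    exact ((eventually_ge_atTop 1).and (h.eventually_lt_const hc)).exists
  have hM0 : 0 < M := one_pos.trans_le hM
  obtain ⟨N, hN⟩ := exists_pow_lt_of_lt_one (inv_pos.mpr hM0) hτ₂
  obtain ⟨L, hL⟩ := exists_nat_gt (C₀ / (C₀⁻¹ / 4 * τ₁))
  refine ⟨L * N, fun a ha han E μ _ hμE hF t ht => ?_⟩
  have hna : 0 ≤ (L * N : ℕ) * a := by positivity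
  obtain ⟨j, hj, hmid⟩ := ht.exists_sub_lt hτ₁ (hτ.trans hτ₂.le) (hτ₁.le.trans hτ) hM0 hN.le hc.le
    ha ((div_lt_iff₀ (by positivity)).mp hL) (by linarith) monotone_partialFourierIntegral
    partialFourierIntegral_nonneg fun T hT => (hF T hT).2
  have htj := ht.mem_Ioc hj
  refine ⟨j, hj, mem_distanceSet_of_partialFourierIntegral_sub_le hσ hμE hB
    (hasBallGrowth_energyMeasure fun T hT => (hF T hT).2) (by norm_num) (by linarith) (by linarith)
    hC₀.le htj hM hMB ?_ hmid.le⟩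
  rw [mul_div_cancel₀ _ four_ne_zero]
  exact (hF _ ((one_le_div htj.1).mpr htj.2)).1

theorem theorem1p6_general {d : ℕ} (hd : 2 ≤ d) {C₀ : ℝ} (hC₀ : 0 < C₀) {τ₁ τ₂ : ℝ}
    (hτ₁ : 0 < τ₁) (hτ : τ₁ ≤ τ₂) (hτ₂ : τ₂ < 1) :
    ∃ (ε₀ : ℝ) (J₀ : ℕ), 0 < ε₀ ∧ ε₀ < 1 ∧ 1 ≤ J₀ ∧
      ∀ (s : ℝ), (d : ℝ) - ε₀ < s → s ≤ d →
      ∀ (E : Set (EuclideanSpace ℝ (Fin d))) (μ : Measure (EuclideanSpace ℝ (Fin d))),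
        IsProbabilityMeasure μ → μ Eᶜ = 0 →
        (∀ T : ℝ, 1 ≤ T →
          C₀⁻¹ * T ^ ((d : ℝ) - s) ≤ partialFourierIntegral μ T ∧
            partialFourierIntegral μ T ≤ C₀ * T ^ ((d : ℝ) - s)) →
        (∀ t : ℕ → ℝ, IsLacunary τ₁ τ₂ J₀ t →
          1 ≤ (distanceSet E ∩ t '' Set.Icc 1 J₀).encard) ∧
        (∀ t : ℕ → ℝ, IsLacunary τ₁ τ₂ ⊤ t →
          ∀ k : ℕ, ∃ j ∈ Set.Icc (k + 1) (k + J₀), t j ∈ distanceSet E) := by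
  obtain ⟨n, hn⟩ := exists_index_mem_distanceSet hd hC₀ hτ₁ hτ hτ₂
  have hn4 : (0 : ℝ) < n + 4 := by positivity
  refine ⟨1 / (n + 4), n + 1, by positivity, ?_, by omega, fun s hs hsd E μ hμ hμE hF => ?_⟩
  · rw [div_lt_one hn4]
    linarith [(Nat.cast_nonneg n : (0 : ℝ) ≤ n)]
  have hindex := hn (d - s) (sub_nonneg.mpr hsd) ((le_div_iff₀ hn4).mp (by linarith)) E μ hμ hμE hF
  refine ⟨fun t ht => ?_, fun t ht k => ?_⟩
  · obtain ⟨j, hj, htj⟩ := hindex t ht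
    exact Set.one_le_encard_iff_nonempty.mpr ⟨t j, htj, j, hj, rfl⟩
  · obtain ⟨j, hj, htj⟩ := hindex _ (ht.shift k (n + 1))
    exact ⟨k + j, ⟨Nat.add_le_add_left hj.1 k, Nat.add_le_add_left hj.2 k⟩, htj⟩

theorem theorem1p6 (d : ℕ) (hd : 2 ≤ d) (C₀ : ℝ) (hC₀ : 1 ≤ C₀)
    (τ₁ τ₂ : ℝ) (hτ₁ : 0 < τ₁) (hτ : τ₁ ≤ τ₂) (hτ₂ : τ₂ < 1) :
    ∃ (ε₀ : ℝ) (J₀ : ℕ), 0 < ε₀ ∧ ε₀ < 1 ∧ 1 ≤ J₀ ∧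
      ∀ (s : ℝ), (d : ℝ) - ε₀ < s → s < d →
      ∀ (E : Set (EuclideanSpace ℝ (Fin d))), MeasurableSet E → E ⊆ unitCube d →
        IsQuasiRegular s E →
      ∀ (μ : Measure (EuclideanSpace ℝ (Fin d))), IsProbabilityMeasure μ → μ Eᶜ = 0 →
        IsLocallyUniformlyDimensional s μ →
        (∀ T : ℝ, 1 ≤ T →
          C₀⁻¹ * T ^ ((d : ℝ) - s) ≤ partialFourierIntegral μ T ∧
            partialFourierIntegral μ T ≤ C₀ * T ^ ((d : ℝ) - s)) →
        (∀ t : ℕ → ℝ, IsLacunary τ₁ τ₂ J₀ t →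
          1 ≤ (distanceSet E ∩ t '' Set.Icc 1 J₀).encard) ∧
        (∀ t : ℕ → ℝ, IsLacunary τ₁ τ₂ ⊤ t →
          ∀ k : ℕ, ∃ j ∈ Set.Icc (k + 1) (k + J₀), t j ∈ distanceSet E) := by
  obtain ⟨ε₀, J₀, hε₀, hε₁, hJ₀, h⟩ := theorem1p6_general hd (one_pos.trans_le hC₀) hτ₁ hτ hτ₂
  exact ⟨ε₀, J₀, hε₀, hε₁, hJ₀, fun s hs hsd E _ _ _ μ hμ hμE _ => h s hs hsd.le E μ hμ hμE⟩
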